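/- Let $\alpha\in(1,2]$, $\sigma>0$, $r\in\mathbb{R}$, $u>0$, $S_0>0$. On a filtered probability space $(\Omega,\mathcal{F},(\mathcal{F}_t)_{t\ge 0},\mathbb{Q})$ let $(X_t)_{t\ge0}$ be a Lévy process with respect to $(\mathcal{F}_t)$ (adapted, $X_0=0$ a.s., increments $X_t-X_s$ independent of $\mathcal{F}_s$ and distributed as $X_{t-s}$ for $s\le t$, a.s. càdlàg paths) which is $\alpha$-stable with scale $\sigma$, location $0$ and maximal negative asymmetry $\beta=-1$, i.e. $$\mathbb{E}^{\mathbb{Q}}\big[e^{ikX_t}\big]=\exp\Big(-t\,\sigma^\alpha|k|^\alpha\big(1+i\tan\tfrac{\pi\alpha}{2}\,\mathrm{sgn}\,k\big)\Big)\qquad(t\ge0,\ k\in\mathbb{R}).$$ Put $\mu:=\sigma^\alpha/\cos\frac{\pi\alpha}{2}<0$ and let the asset price be $S_t=S_0e^{(r+\mu)t+X_t}$ (the Finite Moment Log Stable model). For $0\le t<T$ let $\tau:=T-t$, and let the value at time $t$ of an option with payoff $\mathcal{P}(S_T)$ be $\mathbb{E}^{\mathbb{Q}}[e^{-r\tau}\mathcal{P}(S_T)\mid\mathcal{F}_t]$.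 For $K>0$ let $k_u:=\log\frac{S_t}{K^{1/u}}+r\tau$. Below $1/\Gamma$ is the entire reciprocal Gamma function (zero at the poles of $\Gamma$), and $0^0=1$. All payoffs below are integrable, and each of the following identities holds almost surely for each fixed choice of strikes: 1. For every $K>0$, the value at time $t$ of the digital power asset-or-nothing call, with payoff $S_T^u\mathbf{1}_{\{S_T^u-K>0\}}$, is $$C^{(A/N)}(K)=\frac{Ke^{-r\tau}}{\alpha}\sum_{n,m\ge0}\frac{1}{n!\,\Gamma\big(1+\frac{m-n}{\alpha}\big)}\,u^m(k_u+\mu\tau)^n(-\mu\tau)^{\frac{m-n}{\alpha}},$$ where the double series converges absolutely. 2. For all $K_1,K_2>0$, the value at time $t$ of the gap power call, with payoff $(S_T^u-K_1)\mathbf{1}_{\{S_T^u-K_2>0\}}$, is $$C^{(Gap)}(K_1,K_2)=C^{(A/N)}(K_2)-K_1\,C^{(C/N)}(K_2),$$ where $C^{(C/N)}(K_2)$ is the value at time $t$ of the digital power cash-or-nothing call with payoff $\mathbf{1}_{\{S_T^u-K_2>0\}}$. 3. For every $K>0$, the value at time $t$ of the European power call, with payoff $[S_T^u-K]^+$, is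 $$C^{(E)}(K)=\frac{Ke^{-r\tau}}{\alpha}\sum_{n\ge0,\ m\ge1}\frac{1}{n!\,\Gamma\big(1+\frac{m-n}{\alpha}\big)}\,u^m(k_u+\mu\tau)^n(-\mu\tau)^{\frac{m-n}{\alpha}},$$ where the double series converges absolutely. -/

import Mathlib

open MeasureTheory ProbabilityTheory Filter Topology
open scoped NNReal

noncomputable section

/-- `X` is a real Lévy process with respect to the filtration `ℱ` under `Q`: adapted, started at
`0`, with increments that are independent of the past and stationary, and almost surely càdlàg. -/
structure IsLevyProcess {Ω : Type*} {mΩ : MeasurableSpace Ω} (Q : Measure Ω)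
    (ℱ : Filtration ℝ≥0 mΩ) (X : ℝ≥0 → Ω → ℝ) : Prop where
  adapted : ∀ t, Measurable[ℱ t] (X t)
  zero : ∀ᵐ ω ∂Q, X 0 ω = 0
  indep : ∀ s t : ℝ≥0, s ≤ t →
    Indep (MeasurableSpace.comap (fun ω => X t ω - X s ω) inferInstance) (ℱ s) Q
  stationary : ∀ s t : ℝ≥0, s ≤ t →
    IdentDistrib (fun ω => X t ω - X s ω) (X (t - s)) Q Q
  cadlag : ∀ᵐ ω ∂Q, ∀ t : ℝ≥0,
    ContinuousWithinAt (fun s => X s ω) (Set.Ici t) t ∧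
      ∃ l : ℝ, Tendsto (fun s => X s ω) (𝓝[<] t) (𝓝 l)

/-- The characteristic exponent `k ↦ γ^α |k|^α (1 - i β tan(πα/2) sgn k)` of the stable law
with stability index `α ≠ 1`, scale `γ`, asymmetry `β` and location `0`. -/
def stableExponent (α γ β k : ℝ) : ℂ :=
  ((γ ^ α * |k| ^ α : ℝ) : ℂ) *
    (1 - Complex.I * ((β * Real.tan (Real.pi * α / 2) * Real.sign k : ℝ) : ℂ))

/-- The finite moment log stable (FMLS) process: a Lévy process that is stable with index `α`,
scale `σ`, location `0` and maximal negative asymmetry `β = -1`, that is, with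
`E[exp(i k X_t)] = exp(-t Ψ(k))`. -/
structure IsFMLSProcess {Ω : Type*} {mΩ : MeasurableSpace Ω} (Q : Measure Ω)
    (ℱ : Filtration ℝ≥0 mΩ) (α σ : ℝ) (X : ℝ≥0 → Ω → ℝ) : Prop
    extends IsLevyProcess Q ℱ X where
  charFun_eq : ∀ (t : ℝ≥0) (k : ℝ),
    charFun (Q.map (X t)) k = Complex.exp (-((t : ℝ) : ℂ) * stableExponent α σ (-1) k)

/-- The martingale adjustment of the FMLS model. -/
def fmlsAdjustment (α σ : ℝ) : ℝ := σ ^ α / Real.cos (Real.pi * α / 2)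

/-- The asset price `S_t = S₀ exp((r + μ) t + X_t)` of the FMLS model. -/
def fmlsPrice {Ω : Type*} (α σ r S₀ : ℝ) (X : ℝ≥0 → Ω → ℝ) (t : ℝ≥0) (ω : Ω) : ℝ :=
  S₀ * Real.exp ((r + fmlsAdjustment α σ) * t + X t ω)

/-- The value at time `t` of an option with maturity `T` and the given payoff on the asset `S`:
the conditional expectation under `Q` of the payoff discounted at the rate `r`. -/
def optionValue {Ω : Type*} {mΩ : MeasurableSpace Ω} (Q : Measure Ω) (ℱ : Filtration ℝ≥0 mΩ)
    (r : ℝ) (S : ℝ≥0 → Ω → ℝ) (payoff : ℝ → ℝ) (t T : ℝ≥0) : Ω → ℝ :=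
  Q[fun ω => Real.exp (-r * ((T : ℝ) - t)) * payoff (S T ω) | ℱ t]

/-- Payoff of the digital power cash-or-nothing call. -/
def cashOrNothing (u K s : ℝ) : ℝ := Set.indicator {s : ℝ | s ^ u - K > 0} (fun _ => 1) s

/-- Payoff of the digital power asset-or-nothing call. -/
def assetOrNothing (u K s : ℝ) : ℝ := Set.indicator {s : ℝ | s ^ u - K > 0} (fun s => s ^ u) s

/-- Payoff of the gap power call with strike `K₁` and trigger `K₂`. -/
def gapCall (u K₁ K₂ s : ℝ) : ℝ :=
  Set.indicator {s : ℝ | s ^ u - K₂ > 0} (fun s => s ^ u - K₁) s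

/-- Payoff of the European power call. -/
def europeanCall (u K s : ℝ) : ℝ := max (s ^ u - K) 0

/-- The log-forward moneyness `k_u = log(s / K^(1/u)) + r τ`. -/
def logForwardMoneyness (u s K r τ : ℝ) : ℝ := Real.log (s / K ^ (1 / u)) + r * τ

/-- The `(n, m)` term of the pricing series, where `k` is the log-forward moneyness. Since
`Real.Gamma` is `0` at the poles of the Gamma function, `1 / Γ` is `0` there, as it should be. -/
def fmlsTerm (α u μ k τ : ℝ) (n m : ℕ) : ℝ :=
  1 / ((n.factorial : ℝ) * Real.Gamma (1 + ((m : ℝ) - n) / α)) *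
    u ^ m * (k + μ * τ) ^ n * (-(μ * τ)) ^ (((m : ℝ) - n) / α)

end

/-! For `β = -1` the characteristic function of the increment over time `τ` is `k ↦ E(ik)`, where
`E(s) = exp(a s^α)` (`stableLaplace`) with `a = -μτ > 0` is holomorphic on the right half plane.
Since `α > 1` and `cos(πα/2) < 0`, `E` decays faster than any exponential in each vertical strip
(`exists_norm_stableLaplace_le`). So the increment has a density given by Fourier inversion, and the
inversion contour may be moved to any line `Re s = c ≥ 0`.

By independence of increments, option values are integrals against the law `ν` of the increment.
With `x = k_u + μτ`, the asset-or-nothing call needs the integral of `e^{u(x+y)}` over `y > -x`. By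
Fubini this is the integral of `e^{sx} E(s) / (s - u)` along `Re s = c > u`, divided by `2πi`.
Expanding `e^{sx}` and `1/(s-u) = Σ u^m / s^{m+1}` leaves the integrals of `s^{n-m-1} E(s)`, and
domination on the line gives absolute convergence (`IsStableLaw.hasSum_setIntegral_exp`).

The integral of `s^p E(s)` is found in `stableMellin_eq`. For `p > 0` the line moves to the
imaginary axis, where two Gamma integrals and the reflection formula produce `1/Γ(1 - (p+1)/α)`;
both sides are entire in `p`, so the formula persists for all `p`.

The cash-or-nothing call is the case of exponent `0`, where only `m = 0` survives. The European call
is the gap call with equal strikes, and the subtraction deletes the terms with `m = 0`. -/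

/-! ### Decay of `exp(a s^α)` in vertical strips. -/

section StableKernel

open Complex

/-- Cosine is 1-Lipschitz, and Jordan's inequality bounds `π/2 - |arg s|` by `π/2` times its sine,
which is `Re s / ‖s‖`. In a vertical strip the error is thus `O(1/‖s‖)`. -/
lemma cos_mul_arg_le {α : ℝ} (hα : 1 < α) {s : ℂ} (hs : s ≠ 0) (hre : 0 ≤ s.re) :
    Real.cos (α * s.arg) ≤
      Real.cos (Real.pi * α / 2) + α * (Real.pi / 2) * (s.re / ‖s‖) := by
  have habs : |s.arg| ≤ Real.pi / 2 := Complex.abs_arg_le_pi_div_two_iff.2 hre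
  have h1 : Real.cos (α * s.arg) = Real.cos (α * |s.arg|) := by
    rw [← Real.cos_abs (α * s.arg), abs_mul, abs_of_pos (by linarith : 0 < α)]
  have h2 : Real.cos (α * |s.arg|) - Real.cos (Real.pi * α / 2) ≤
      α * (Real.pi / 2 - |s.arg|) := by
    refine (le_abs_self _).trans ((Real.abs_cos_sub_cos_le _ _).trans ?_)
    rw [abs_sub_comm, abs_of_nonneg] <;> nlinarith
  have h3 : Real.pi / 2 - |s.arg| ≤ Real.pi / 2 * (s.re / ‖s‖) := by
    have := Real.mul_le_sin (x := Real.pi / 2 - |s.arg|) (by linarith)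
      (by linarith [abs_nonneg s.arg])
    rw [Real.sin_pi_div_two_sub, Real.cos_abs, Complex.cos_arg hs] at this
    have hp := Real.pi_pos
    calc Real.pi / 2 - |s.arg| = Real.pi / 2 * (2 / Real.pi * (Real.pi / 2 - |s.arg|)) := by
          field_simp
      _ ≤ _ := by gcongr
  have : α * (Real.pi / 2 - |s.arg|) ≤ α * (Real.pi / 2 * (s.re / ‖s‖)) := by gcongr
  linarith

lemma re_cpow_ofReal (s : ℂ) (hs : s ≠ 0) (α : ℝ) :
    (s ^ (α : ℂ)).re = ‖s‖ ^ α * Real.cos (α * s.arg) := by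
  rw [Complex.cpow_def_of_ne_zero hs, Complex.exp_re, Real.rpow_def_of_pos (norm_pos_iff.2 hs)]
  simp [Complex.log_re, Complex.log_im, mul_comm]

lemma re_cpow_le {α : ℝ} (hα : 1 < α) {s : ℂ} (hre : 0 ≤ s.re) :
    (s ^ (α : ℂ)).re ≤
      Real.cos (Real.pi * α / 2) * ‖s‖ ^ α + α * (Real.pi / 2) * s.re * ‖s‖ ^ (α - 1) := by
  rcases eq_or_ne s 0 with rfl | hs
  · have : (α : ℂ) ≠ 0 := by exact_mod_cast (by linarith : α ≠ 0)
    simp [Complex.zero_cpow this, Real.zero_rpow (by linarith : α ≠ 0)]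
  · have hn := norm_pos_iff.2 hs
    rw [re_cpow_ofReal s hs, Real.rpow_sub_one hn.ne']
    have := mul_le_mul_of_nonneg_left (cos_mul_arg_le hα hs hre) (Real.rpow_nonneg hn.le α)
    refine this.trans (le_of_eq ?_)
    field_simp

lemma cos_pi_mul_div_two_neg {α : ℝ} (hα : 1 < α) (hα' : α ≤ 2) :
    Real.cos (Real.pi * α / 2) < 0 := by
  have := Real.pi_pos
  exact Real.cos_neg_of_pi_div_two_lt_of_lt (by nlinarith) (by nlinarith)

lemma exists_sub_mul_rpow_le {α δ : ℝ} (hα : 1 < α) (hδ : 0 < δ) (B : ℝ) :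
    ∃ M, ∀ r : ℝ, 0 ≤ r → B * r - δ * r ^ α ≤ M := by
  obtain ⟨R, hR⟩ := ((tendsto_rpow_atTop (sub_pos.2 hα)).eventually_ge_atTop
    (|B| / δ)).exists_forall_of_atTop
  refine ⟨|B| * |R|, fun r hr => ?_⟩
  have hB := le_abs_self B
  rcases le_or_gt R r with h | h
  · have h1 := hR r h
    rcases hr.eq_or_lt with rfl | hr
    · simp [Real.zero_rpow (by linarith : α ≠ 0)]; positivity
    · have h2 : r ^ α = r ^ (α - 1) * r := by
        rw [Real.rpow_sub_one hr.ne']; field_simp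
      rw [div_le_iff₀ hδ] at h1
      have h3 : |B| * r ≤ r ^ (α - 1) * δ * r := by gcongr
      have h4 : 0 ≤ |B| * |R| := by positivity
      rw [h2]
      nlinarith
  · have : |B| * r ≤ |B| * |R| := by
      have := le_abs_self R
      gcongr
      linarith
    have h4 : 0 ≤ δ * r ^ α := by positivity
    nlinarith

/-- The holomorphic function `exp (a s^α)`, whose boundary values on the imaginary axis are the
characteristic function of a totally asymmetric stable law. -/
noncomputable def stableLaplace (α a : ℝ) (s : ℂ) : ℂ := cexp (a * s ^ (α : ℂ))

/-- The real part of the exponent is a negative multiple of `‖s‖^α` plus `O(1 + ‖s‖)`, so any linear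
rate is beaten. Freedom in `A` later pays for powers of `s`, for `e^{-sy}` and for the majorants of
the series. -/
lemma exists_norm_stableLaplace_le {α a : ℝ} (hα : 1 < α) (hα' : α ≤ 2) (ha : 0 < a)
    {c : ℝ} (hc : 0 ≤ c) (A : ℝ) :
    ∃ M, 0 < M ∧ ∀ s : ℂ, 0 ≤ s.re → s.re ≤ c →
      ‖stableLaplace α a s‖ ≤ M * Real.exp (-(A * ‖s‖)) := by
  have hcos := cos_pi_mul_div_two_neg hα hα'
  set B := a * (α * (Real.pi / 2) * c) with hB
  obtain ⟨M, hM⟩ := exists_sub_mul_rpow_le hα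
    (mul_pos ha (neg_pos.2 hcos)) (B + A)
  refine ⟨Real.exp (M + B), Real.exp_pos _, fun s h0 h1 => ?_⟩
  have hpi := Real.pi_pos
  rw [stableLaplace, Complex.norm_exp, ← Real.exp_add, Real.exp_le_exp, Complex.re_ofReal_mul]
  have h2 := re_cpow_le hα h0
  -- Here `α ≤ 2` makes the correction term at most linear.
  have h3 : ‖s‖ ^ (α - 1) ≤ 1 + ‖s‖ := by
    rcases le_or_gt ‖s‖ 1 with h | h
    · have := Real.rpow_le_one (norm_nonneg s) h (by linarith : 0 ≤ α - 1)
      linarith [norm_nonneg s]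
    · have := Real.rpow_le_rpow_of_exponent_le h.le (by linarith : α - 1 ≤ 1)
      rw [Real.rpow_one] at this
      linarith
  have h4 : α * (Real.pi / 2) * s.re * ‖s‖ ^ (α - 1) ≤ α * (Real.pi / 2) * c * (1 + ‖s‖) := by
    gcongr
  have h5 := hM ‖s‖ (norm_nonneg s)
  have h6 := mul_le_mul_of_nonneg_left (h2.trans (add_le_add_right h4 _)) ha.le
  refine h6.trans ?_
  have : a * (Real.cos (Real.pi * α / 2) * ‖s‖ ^ α + α * (Real.pi / 2) * c * (1 + ‖s‖)) =
    (B + A) * ‖s‖ - a * -Real.cos (Real.pi * α / 2) * ‖s‖ ^ α + B - A * ‖s‖ := by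
    rw [hB]; ring
  linarith

lemma continuousOn_stableLaplace {α : ℝ} (hα : 1 < α) (a : ℝ) :
    ContinuousOn (stableLaplace α a) {s | 0 ≤ s.re} := by
  intro s hs
  refine ContinuousAt.continuousWithinAt ?_
  exact (continuousAt_const.mul (Complex.continuousAt_cpow_const_of_re_pos (Or.inl hs)
    (by simp; linarith))).cexp

lemma differentiableAt_stableLaplace (α a : ℝ) {s : ℂ} (hs : 0 < s.re) :
    DifferentiableAt ℂ (stableLaplace α a) s :=
  ((differentiableAt_id.cpow_const (Or.inl hs)).const_mul _).cexp

end StableKernel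

/-! ### Moving vertical contours. -/

section VerticalLine

open Complex

lemma continuous_verticalLine (c : ℝ) : Continuous fun y : ℝ => (c : ℂ) + y * I := by fun_prop

lemma abs_le_norm_verticalLine (c y : ℝ) : |y| ≤ ‖(c : ℂ) + y * I‖ := by
  simpa using Complex.abs_im_le_norm ((c : ℂ) + y * I)

lemma integrable_exp_neg_abs : Integrable (fun y : ℝ => Real.exp (-|y|)) := by
  have h : IntegrableOn (fun y : ℝ => Real.exp (-y)) (Set.Ioi 0) := integrableOn_exp_neg_Ioi 0
  rw [← integrableOn_univ, ← Set.Iic_union_Ioi (a := (0 : ℝ))]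
  refine IntegrableOn.union ?_ ?_
  · refine (integrableOn_exp_Iic 0).congr_fun (fun y hy => ?_) measurableSet_Iic
    simp [abs_of_nonpos (Set.mem_Iic.1 hy)]
  · refine h.congr_fun (fun y hy => ?_) measurableSet_Ioi
    simp [abs_of_pos (Set.mem_Ioi.1 hy)]

/-- A continuous function on the right half plane, holomorphic in the interior and exponentially
small at infinity in a vertical strip, has the same integral over both sides of the strip. -/
lemma integral_verticalLine_eq {F : ℂ → ℂ} (hF : ContinuousOn F {s | 0 ≤ s.re})
    (hd : ∀ s : ℂ, 0 < s.re → DifferentiableAt ℂ F s) {b c C : ℝ} (hb : 0 ≤ b) (hbc : b ≤ c)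
    (hC : ∀ s : ℂ, b ≤ s.re → s.re ≤ c → ‖F s‖ ≤ C * Real.exp (-‖s‖)) :
    ∫ y : ℝ, F (b + y * I) = ∫ y : ℝ, F (c + y * I) := by
  have hint : ∀ d : ℝ, b ≤ d → d ≤ c → Integrable (fun y : ℝ => F (d + y * I)) := by
    intro d h1 h2
    refine (integrable_exp_neg_abs.const_mul |C|).mono' ?_ (.of_forall fun y => ?_)
    · exact (hF.comp_continuous (continuous_verticalLine d)
        (fun y => by simp; linarith)).aestronglyMeasurable
    · refine (hC _ (by simpa) (by simpa)).trans ?_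
      have := abs_le_norm_verticalLine d y
      exact mul_le_mul (le_abs_self _) (Real.exp_le_exp.2 (by linarith)) (Real.exp_pos _).le
        (abs_nonneg _)
  -- Cauchy's theorem on a rectangle, needing only continuity on its boundary. Hence `b = 0` is
  -- allowed, where the integrands need not be holomorphic on the edge.
  have hrect : ∀ R : ℝ, (∫ x : ℝ in b..c, F (x + (-R : ℝ) * I)) - (∫ x : ℝ in b..c, F (x + R * I)) +
      I • (∫ y : ℝ in (-R)..R, F (c + y * I)) - I • (∫ y : ℝ in (-R)..R, F (b + y * I)) = 0 := by
    intro R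
    have := Complex.integral_boundary_rect_eq_zero_of_continuousOn_of_differentiableOn F
      ⟨b, -R⟩ ⟨c, R⟩ (hF.mono ?_) ?_
    · simpa using this
    · intro s hs
      have := hs.1
      simp [Set.uIcc_of_le hbc] at this
      exact hb.trans this.1
    · intro s hs
      have := hs.1
      simp [min_eq_left hbc] at this
      exact (hd s (hb.trans_lt this.1)).differentiableWithinAt
  have hside : ∀ ε : ℝ, |ε| = 1 →
      Tendsto (fun R : ℝ => ∫ x : ℝ in b..c, F (x + (ε * R : ℝ) * I)) atTop (𝓝 0) := by
    intro ε hε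
    have hb : ∀ R : ℝ, 0 ≤ R → ‖∫ x : ℝ in b..c, F (x + (ε * R : ℝ) * I)‖ ≤
        |C| * Real.exp (-R) * |c - b| := by
      intro R hR
      refine intervalIntegral.norm_integral_le_of_norm_le_const fun x hx => ?_
      rw [Set.uIoc_of_le hbc] at hx
      refine (hC _ (by simpa using hx.1.le) (by simpa using hx.2)).trans ?_
      have := abs_le_norm_verticalLine x (ε * R)
      rw [abs_mul, hε, one_mul] at this
      exact mul_le_mul (le_abs_self _) (Real.exp_le_exp.2 (by linarith [le_abs_self R]))
        (Real.exp_pos _).le (abs_nonneg _)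
    refine squeeze_zero_norm' ((eventually_ge_atTop 0).mono hb) ?_
    have := (Real.tendsto_exp_neg_atTop_nhds_zero.const_mul |C|).mul_const |c - b|
    simpa using this
  have h1 := hside 1 (by simp)
  have h2 := hside (-1) (by simp)
  simp only [one_mul, neg_mul] at h1 h2
  have h3 := intervalIntegral_tendsto_integral (hint c hbc le_rfl) tendsto_neg_atTop_atBot
    tendsto_id
  have h4 := intervalIntegral_tendsto_integral (hint b le_rfl hbc) tendsto_neg_atTop_atBot
    tendsto_id
  have h5 := ((h2.sub h1).add (h3.const_smul I)).sub (h4.const_smul I)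
  have h6 := tendsto_nhds_unique h5 ((tendsto_const_nhds (x := (0 : ℂ))).congr
    (fun R => (hrect R).symm))
  have h7 : I * ((∫ y : ℝ, F (c + y * I)) - ∫ y : ℝ, F (b + y * I)) = 0 := by
    simpa [mul_sub] using h6
  rcases mul_eq_zero.1 h7 with h | h
  · exact absurd h I_ne_zero
  · exact (sub_eq_zero.1 h).symm

end VerticalLine

/-! ### Holomorphic parameter integrals and the Gamma integral with complex rate. -/

section ParametricIntegral

open Complex

/-- An integral depending holomorphically on a parameter, with an integrand bounded by a fixed
integrable function, is holomorphic. -/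
lemma differentiableOn_integral_of_dominated {β : Type*} {mβ : MeasurableSpace β} {μ : Measure β}
    {F : ℂ → β → ℂ} {U : Set ℂ} (hU : IsOpen U) {bound : β → ℝ}
    (hm : ∀ z ∈ U, AEStronglyMeasurable (F z) μ)
    (hd : ∀ᵐ b ∂μ, DifferentiableOn ℂ (fun z => F z b) U)
    (hbd : ∀ᵐ b ∂μ, ∀ z ∈ U, ‖F z b‖ ≤ bound b) (hi : Integrable bound μ) :
    DifferentiableOn ℂ (fun z => ∫ b, F z b ∂μ) U := by
  intro z₀ hz₀
  obtain ⟨r, hr, hrU⟩ := Metric.isOpen_iff.1 hU z₀ hz₀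
  have hsub : ∀ z ∈ Metric.ball z₀ (r / 2), Metric.closedBall z (r / 4) ⊆ U := by
    intro z hz w hw
    refine hrU ?_
    rw [Metric.mem_ball] at hz ⊢
    rw [Metric.mem_closedBall] at hw
    linarith [dist_triangle w z z₀]
  have hder : ∀ᵐ b ∂μ, ∀ z ∈ Metric.ball z₀ (r / 2),
      HasDerivAt (fun z => F z b) (deriv (fun z => F z b) z) z := by
    filter_upwards [hd] with b hb z hz
    exact (hb.differentiableAt (hU.mem_nhds (hsub z hz
      (Metric.mem_closedBall_self (by linarith))))).hasDerivAt
  refine (hasDerivAt_integral_of_dominated_loc_of_deriv_le (bound := fun b => bound b / (r / 4))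
    (F' := fun z b => deriv (fun z => F z b) z)
    (Metric.ball_mem_nhds z₀ (half_pos hr)) ?_ ?_ ?_ ?_ ?_
    hder).2.differentiableAt.differentiableWithinAt
  · filter_upwards [hU.mem_nhds hz₀] with z hz using hm z hz
  · exact hi.mono' (hm z₀ hz₀) (hbd.mono fun b hb => hb z₀ hz₀)
  -- The derivative in the parameter is measurable as a limit of difference quotients along these
  -- nonzero steps, which stay below `r`.
  · have hlim : Tendsto (fun n : ℕ => ((r / 2 / ((n : ℝ) + 2) : ℝ) : ℂ)) atTop (𝓝[≠] 0) := by
      refine tendsto_nhdsWithin_iff.2 ⟨?_, .of_forall fun n => ?_⟩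
      · have h : Tendsto (fun n : ℕ => r / 2 / ((n : ℝ) + 2)) atTop (𝓝 0) :=
          tendsto_const_nhds.div_atTop
            (tendsto_atTop_add_const_right _ _ tendsto_natCast_atTop_atTop)
        exact ofReal_zero ▸ (Complex.continuous_ofReal.tendsto 0).comp h
      · have : r / 2 / ((n : ℝ) + 2) ≠ 0 := by positivity
        simpa only [Set.mem_compl_iff, Set.mem_singleton_iff, Complex.ofReal_eq_zero] using this
    refine aestronglyMeasurable_of_tendsto_ae atTop
      (f := fun (n : ℕ) b => ((r / 2 / ((n : ℝ) + 2) : ℝ) : ℂ)⁻¹ •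
        (F (z₀ + ((r / 2 / ((n : ℝ) + 2) : ℝ) : ℂ)) b - F z₀ b)) (fun n => ?_) ?_
    · refine ((hm _ (hrU ?_)).sub (hm z₀ hz₀)).const_smul
        (((r / 2 / ((n : ℝ) + 2) : ℝ) : ℂ)⁻¹)
      have h2 : 0 ≤ r / 2 / ((n : ℝ) + 2) := by positivity
      have h3 : r / 2 / ((n : ℝ) + 2) < r := by
        rw [div_lt_iff₀ (by positivity)]
        nlinarith [(Nat.cast_nonneg n : (0 : ℝ) ≤ n)]
      rw [Metric.mem_ball, dist_eq_norm, add_sub_cancel_left, Complex.norm_real, Real.norm_eq_abs,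
        abs_of_nonneg h2]
      exact h3
    · filter_upwards [hder] with b hb
      exact (hb z₀ (Metric.mem_ball_self (half_pos hr))).tendsto_slope_zero.comp hlim
  · filter_upwards [hd, hbd] with b hb hb' z hz
    -- Cauchy's estimate on a circle of radius `r / 4` turns the bound on the integrand into one on
    -- its derivative.
    refine Complex.norm_deriv_le_of_forall_mem_sphere_norm_le (by linarith)
      (hb.mono (?_ : closure (Metric.ball z (r / 4)) ⊆ U)).diffContOnCl fun w hw =>
      hb' w (hsub z hz (Metric.sphere_subset_closedBall hw))
    exact Metric.closure_ball_subset_closedBall.trans (hsub z hz)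
  · exact hi.div_const _

lemma differentiableOn_integral_rpow_mul_exp {w : ℝ} (hw : 0 < w) :
    DifferentiableOn ℂ (fun r : ℂ => ∫ t : ℝ in Set.Ioi 0, ((t ^ (w - 1) : ℝ) : ℂ) * cexp (-(r * t)))
      {r | 0 < r.re} := by
  intro r₀ hr₀
  have hr₀' : 0 < r₀.re / 2 := half_pos hr₀
  have ho : IsOpen {r : ℂ | r₀.re / 2 < r.re} := isOpen_lt continuous_const Complex.continuous_re
  refine DifferentiableOn.differentiableAt (s := {r : ℂ | r₀.re / 2 < r.re}) ?_
    (ho.mem_nhds (show r₀.re / 2 < r₀.re from half_lt_self hr₀)) |>.differentiableWithinAt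
  refine differentiableOn_integral_of_dominated ho
    (bound := fun t : ℝ => t ^ (w - 1) * Real.exp (-(r₀.re / 2) * t)) ?_ ?_ ?_ ?_
  · intro z _
    refine ContinuousOn.aestronglyMeasurable (fun t ht => ContinuousAt.continuousWithinAt ?_)
      measurableSet_Ioi
    have := Real.continuousAt_rpow_const t (w - 1) (Or.inl (ne_of_gt ht))
    fun_prop
  · exact .of_forall fun t => by fun_prop
  · refine (ae_restrict_iff' measurableSet_Ioi).2 (.of_forall fun t ht z hz => ?_)
    have ht : 0 < t := ht
    have hz : r₀.re / 2 < z.re := hz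
    rw [norm_mul, Complex.norm_real, Real.norm_of_nonneg (by positivity), Complex.norm_exp]
    gcongr
    simp
    gcongr
  · have := integrableOn_rpow_mul_exp_neg_mul_rpow (s := w - 1) (p := 1) (b := r₀.re / 2)
      (by linarith) one_pos hr₀'
    simpa [IntegrableOn] using this

/-- Real points accumulating at `1`, as input to the identity theorem. -/
lemma tendsto_one_add_one_div_nhdsNE :
    Tendsto (fun n : ℕ => ((1 + 1 / ((n : ℝ) + 1) : ℝ) : ℂ)) atTop (𝓝[≠] 1) := by
  refine tendsto_nhdsWithin_iff.2 ⟨?_, .of_forall fun n => ?_⟩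
  · have h : Tendsto (fun n : ℕ => 1 + 1 / ((n : ℝ) + 1)) atTop (𝓝 (1 + 0)) :=
      tendsto_const_nhds.add tendsto_one_div_add_atTop_nhds_zero_nat
    rw [add_zero] at h
    exact ofReal_one ▸ (Complex.continuous_ofReal.tendsto 1).comp h
  · have : (1 + 1 / ((n : ℝ) + 1)) ≠ 1 := by
      have : 0 < 1 / ((n : ℝ) + 1) := by positivity
      linarith
    simpa only [Set.mem_compl_iff, Set.mem_singleton_iff, Complex.ofReal_eq_one] using this

/-- The Gamma integral with a complex rate. -/
lemma integral_rpow_mul_cexp_neg_mul_Ioi {w : ℝ} (hw : 0 < w) {r : ℂ} (hr : 0 < r.re) :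
    ∫ t : ℝ in Set.Ioi 0, ((t ^ (w - 1) : ℝ) : ℂ) * cexp (-(r * t)) =
      r ^ (-w : ℂ) * Real.Gamma w := by
  have ho : IsOpen {r : ℂ | 0 < r.re} := isOpen_lt continuous_const Complex.continuous_re
  have hconv : IsPreconnected {r : ℂ | 0 < r.re} := (convex_halfSpace_re_gt 0).isPreconnected
  have h1 := (differentiableOn_integral_rpow_mul_exp hw).analyticOnNhd ho
  have h2 : AnalyticOnNhd ℂ (fun r : ℂ => r ^ (-w : ℂ) * Real.Gamma w) {r | 0 < r.re} :=
    DifferentiableOn.analyticOnNhd (fun z hz => ((differentiableAt_id.cpow_const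
      (Or.inl hz)).mul_const _).differentiableWithinAt) ho
  -- Both sides are holomorphic in the rate, so agreement at real rates near `1` suffices.
  refine h1.eqOn_of_preconnected_of_frequently_eq h2 hconv (z₀ := 1) (by simp) ?_ hr
  refine tendsto_one_add_one_div_nhdsNE.frequently (Frequently.of_forall fun n => ?_)
  set x : ℝ := 1 + 1 / ((n : ℝ) + 1) with hx
  have hx0 : 0 < x := by positivity
  have h3 := Real.integral_rpow_mul_exp_neg_mul_Ioi hw hx0
  rw [one_div, Real.inv_rpow hx0.le, ← Real.rpow_neg hx0.le] at h3
  have h4 := congrArg (fun x : ℝ => (x : ℂ)) h3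
  simp only [Complex.ofReal_mul, Complex.ofReal_cpow hx0.le, Complex.ofReal_neg] at h4
  rw [← h4, ← integral_complex_ofReal]
  simp

end ParametricIntegral

/-! ### The integral of `s^p exp(a s^α)` is entire in `p`. -/

section StableIntegral

open Complex

lemma norm_cpow_le_mul_exp (s p : ℂ) :
    ‖s ^ p‖ ≤ ‖s‖ ^ p.re * Real.exp (Real.pi * |p.im|) := by
  refine (Complex.norm_cpow_le s p).trans ?_
  rw [div_eq_mul_inv, ← Real.exp_neg]
  gcongr
  have h1 := Complex.abs_arg_le_pi s
  have h2 : |s.arg * p.im| ≤ Real.pi * |p.im| := by rw [abs_mul]; gcongr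
  linarith [neg_abs_le (s.arg * p.im)]

/-- From `‖s‖^N / N! ≤ e^{‖s‖}`. The bound is uniform for `p` in a ball, as differentiation under
the integral requires. -/
lemma norm_cpow_le_of_one_le {s : ℂ} (hs : 1 ≤ ‖s‖) {p : ℂ} {N : ℕ} (hp : ‖p‖ ≤ N) :
    ‖s ^ p‖ ≤ N.factorial * Real.exp (Real.pi * N) * Real.exp ‖s‖ := by
  have h1 : ‖s‖ ^ p.re ≤ N.factorial * Real.exp ‖s‖ := by
    calc ‖s‖ ^ p.re ≤ ‖s‖ ^ (N : ℝ) :=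
          Real.rpow_le_rpow_of_exponent_le hs ((Complex.re_le_norm p).trans hp)
      _ = ‖s‖ ^ N := Real.rpow_natCast _ _
      _ ≤ _ := by
        have := Real.pow_div_factorial_le_exp ‖s‖ (norm_nonneg s) N
        rwa [div_le_iff₀ (by positivity), mul_comm] at this
  have h2 : Real.exp (Real.pi * |p.im|) ≤ Real.exp (Real.pi * N) := by
    have := Real.pi_pos
    gcongr
    exact (Complex.abs_im_le_norm p).trans hp
  calc _ ≤ _ := norm_cpow_le_mul_exp s p
    _ ≤ (N.factorial * Real.exp ‖s‖) * Real.exp (Real.pi * N) := by gcongr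
    _ = _ := by ring

/-- The integral of `s^p exp (a s^α)` over the vertical line with real part `c`. -/
noncomputable def stableMellin (α a c : ℝ) (p : ℂ) : ℂ :=
  ∫ y : ℝ, ((c : ℂ) + y * I) ^ p * stableLaplace α a (c + y * I)

lemma verticalLine_mem_slitPlane {c : ℝ} (hc : 0 < c) (y : ℝ) :
    (c : ℂ) + y * I ∈ slitPlane := Or.inl (by simpa)

lemma differentiable_stableMellin {α a c : ℝ} (hα : 1 < α) (hα' : α ≤ 2) (ha : 0 < a)
    (hc : 1 ≤ c) : Differentiable ℂ (stableMellin α a c) := by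
  intro p
  obtain ⟨N, hN⟩ := exists_nat_gt ‖p‖
  -- Rate `2`: one unit absorbs the factor `e^{‖s‖}` bounding `s^p`, the other leaves an integrable
  -- `e^{-|y|}`.
  obtain ⟨M, hM0, hM⟩ := exists_norm_stableLaplace_le hα hα' ha (by linarith : 0 ≤ c) 2
  have hc0 : 0 < c := by linarith
  refine DifferentiableOn.differentiableAt (s := Metric.ball 0 N) ?_
    (Metric.isOpen_ball.mem_nhds (by simpa using hN))
  refine differentiableOn_integral_of_dominated Metric.isOpen_ball
    (bound := fun y => N.factorial * Real.exp (Real.pi * N) * M * Real.exp (-|y|)) ?_ ?_ ?_ ?_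
  · intro z _
    refine Continuous.aestronglyMeasurable (Continuous.mul ?_ ?_)
    · exact (continuous_verticalLine c).cpow continuous_const (verticalLine_mem_slitPlane hc0)
    · exact (continuousOn_stableLaplace hα a).comp_continuous (continuous_verticalLine c)
        fun y => by simp; linarith
  · refine .of_forall fun y => ?_
    have h0 : (c : ℂ) + y * I ≠ 0 := slitPlane_ne_zero (verticalLine_mem_slitPlane hc0 y)
    exact fun z _ => ((differentiableAt_id.const_cpow (Or.inl h0)).mul_const
      _).differentiableWithinAt
  · refine .of_forall fun y z hz => ?_
    rw [norm_mul]
    have h1 : 1 ≤ ‖(c : ℂ) + y * I‖ := by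
      have := Complex.re_le_norm ((c : ℂ) + y * I)
      simp at this
      linarith
    have h2 := norm_cpow_le_of_one_le h1 (p := z) (N := N) (by simpa using (mem_ball_zero_iff.1 hz).le)
    have h3 := hM (c + y * I) (by simp; linarith) (by simp)
    refine (mul_le_mul h2 h3 (norm_nonneg _) (by positivity)).trans ?_
    have h4 := abs_le_norm_verticalLine c y
    have h5 : Real.exp ‖(c : ℂ) + y * I‖ * Real.exp (-(2 * ‖(c : ℂ) + y * I‖)) ≤ Real.exp (-|y|) := by
      rw [← Real.exp_add, Real.exp_le_exp]; linarith
    calc _ = N.factorial * Real.exp (Real.pi * N) * M * (Real.exp ‖(c : ℂ) + y * I‖ *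
          Real.exp (-(2 * ‖(c : ℂ) + y * I‖))) := by ring
      _ ≤ _ := by gcongr
  · exact integrable_exp_neg_abs.const_mul _

end StableIntegral

/-! ### Closed form of the integral of `s^p exp(a s^α)`. -/

section StableIntegralEval

open Complex

lemma ofReal_mul_cpow {y : ℝ} (hy : 0 < y) {x : ℂ} (hx : x ≠ 0) (p : ℂ) :
    ((y : ℂ) * x) ^ p = (y : ℂ) ^ p * x ^ p := by
  have hy' : (y : ℂ) ≠ 0 := by exact_mod_cast hy.ne'
  rw [cpow_def_of_ne_zero (mul_ne_zero hy' hx), cpow_def_of_ne_zero hy', cpow_def_of_ne_zero hx,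
    Complex.log_ofReal_mul hy hx, ← Complex.exp_add, ← Complex.ofReal_log hy.le, add_mul]

lemma exp_ofReal_mul_I_cpow {θ : ℝ} (h1 : -Real.pi < θ) (h2 : θ ≤ Real.pi) (p : ℂ) :
    cexp (θ * I) ^ p = cexp (θ * p * I) := by
  rw [cpow_def_of_ne_zero (Complex.exp_ne_zero _), Complex.log_exp (by simpa) (by simpa)]
  ring_nf

lemma sign_mul_I_cpow {ε : ℝ} (hε : ε = 1 ∨ ε = -1) (q : ℂ) :
    ((ε : ℂ) * I) ^ q = cexp (((ε * (Real.pi / 2) : ℝ) : ℂ) * q * I) := by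
  have hpi := Real.pi_pos
  have hζ : (ε : ℂ) * I = cexp (((ε * (Real.pi / 2) : ℝ) : ℂ) * I) := by
    rcases hε with rfl | rfl
    · simp [Complex.exp_pi_div_two_mul_I]
    · simp [neg_mul, Complex.exp_neg, Complex.exp_pi_div_two_mul_I]
  rw [hζ, exp_ofReal_mul_I_cpow] <;> rcases hε with rfl | rfl <;> linarith

lemma integral_rpow_mul_cexp_neg_mul_rpow {α p : ℝ} (hα : 0 < α) (hp : -1 < p) {b : ℂ}
    (hb : 0 < b.re) :
    ∫ y : ℝ in Set.Ioi 0, ((y ^ p : ℝ) : ℂ) * cexp (-(b * ((y ^ α : ℝ) : ℂ))) =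
      1 / α * (b ^ (-((p + 1) / α : ℝ) : ℂ) * Real.Gamma ((p + 1) / α)) := by
  have hw : 0 < (p + 1) / α := div_pos (by linarith) hα
  rw [← integral_rpow_mul_cexp_neg_mul_Ioi hw hb, ← integral_comp_rpow_Ioi_of_pos
    (g := fun t : ℝ => ((t ^ ((p + 1) / α - 1) : ℝ) : ℂ) * cexp (-(b * t))) hα, ← integral_const_mul]
  refine setIntegral_congr_fun measurableSet_Ioi fun y hy => ?_
  have hy : 0 < y := hy
  have h : y ^ p = y ^ (α - 1) * (y ^ α) ^ ((p + 1) / α - 1) := by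
    rw [← Real.rpow_mul hy.le, ← Real.rpow_add hy]
    congr 1
    field_simp
    ring
  have hα' : (α : ℂ) ≠ 0 := by exact_mod_cast hα.ne'
  simp only [h, Complex.real_smul, Complex.ofReal_mul]
  field_simp

lemma integral_halfLine_stableLaplace {α a p : ℝ} (hα : 1 < α) (hα' : α ≤ 2) (ha : 0 < a)
    (hp : -1 < p) {ε : ℝ} (hε : ε = 1 ∨ ε = -1) :
    ∫ y : ℝ in Set.Ioi 0, ((y : ℂ) * (ε * I)) ^ (p : ℂ) * stableLaplace α a (y * (ε * I)) =
      1 / α * ((a ^ (-((p + 1) / α)) : ℝ) * Real.Gamma ((p + 1) / α)) *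
        cexp (ε * (Real.pi * ((p + 1) / α) - Real.pi / 2) * I) := by
  have hpi := Real.pi_pos
  have hζ0 : (ε : ℂ) * I ≠ 0 := by rcases hε with rfl | rfl <;> simp
  have hζp := sign_mul_I_cpow hε
  -- On this ray `a s^α = -b y^α`. The shift by `π` absorbs the minus sign and brings the angle
  -- within `π/2` of `0`, so `Re b > 0` and principal powers of `b` are read off from the angle.
  set b : ℂ := a * cexp (((ε * (Real.pi * α / 2 - Real.pi) : ℝ) : ℂ) * I) with hb
  have hcos := cos_pi_mul_div_two_neg hα hα'
  have hbre : 0 < b.re := by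
    rw [hb, Complex.re_ofReal_mul, Complex.exp_ofReal_mul_I_re]
    have : Real.cos (ε * (Real.pi * α / 2 - Real.pi)) = -Real.cos (Real.pi * α / 2) := by
      rcases hε with rfl | rfl
      · rw [one_mul, Real.cos_sub_pi]
      · rw [neg_one_mul, Real.cos_neg, Real.cos_sub_pi]
    rw [this]
    exact mul_pos ha (neg_pos.2 hcos)
  have hbα : b = -(a * ((ε : ℂ) * I) ^ (α : ℂ)) := by
    rw [hζp, hb, ← mul_neg]
    congr 1
    rcases hε with rfl | rfl
    · rw [← mul_neg_one (cexp _), ← Complex.exp_neg_pi_mul_I, ← Complex.exp_add]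
      congr 1
      push_cast
      ring
    · rw [← mul_neg_one (cexp _), ← Complex.exp_pi_mul_I, ← Complex.exp_add]
      congr 1
      push_cast
      ring
  have hbw : b ^ (-((p + 1) / α : ℝ) : ℂ) = (a ^ (-((p + 1) / α)) : ℝ) *
      cexp (((ε * (Real.pi * α / 2 - Real.pi) : ℝ) : ℂ) * (-((p + 1) / α : ℝ) : ℂ) * I) := by
    rw [hb, ofReal_mul_cpow ha (Complex.exp_ne_zero _), exp_ofReal_mul_I_cpow,
      Complex.ofReal_cpow ha.le, Complex.ofReal_neg]
    · rcases hε with rfl | rfl <;> nlinarith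
    · rcases hε with rfl | rfl <;> nlinarith
  have key : ∀ y ∈ Set.Ioi (0 : ℝ),
      ((y : ℂ) * (ε * I)) ^ (p : ℂ) * stableLaplace α a (y * (ε * I)) =
      cexp (((ε * (Real.pi / 2) : ℝ) : ℂ) * p * I) *
        (((y ^ p : ℝ) : ℂ) * cexp (-(b * ((y ^ α : ℝ) : ℂ)))) := by
    intro y hy
    have hy : 0 < y := hy
    rw [stableLaplace, ofReal_mul_cpow hy hζ0, ofReal_mul_cpow hy hζ0, ← hζp, hbα,
      Complex.ofReal_cpow hy.le, Complex.ofReal_cpow hy.le]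
    ring_nf
  rw [setIntegral_congr_fun measurableSet_Ioi key, integral_const_mul,
    integral_rpow_mul_cexp_neg_mul_rpow (by linarith) hp hbre, hbw]
  have hα0 : (α : ℂ) ≠ 0 := by exact_mod_cast (by linarith : α ≠ 0)
  have : cexp (ε * (Real.pi * ((p + 1) / α) - Real.pi / 2) * I) =
      cexp (((ε * (Real.pi / 2) : ℝ) : ℂ) * p * I) *
      cexp (((ε * (Real.pi * α / 2 - Real.pi) : ℝ) : ℂ) * (-((p + 1) / α : ℝ) : ℂ) * I) := by
    rw [← Complex.exp_add]
    congr 1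
    push_cast
    field_simp
    ring
  rw [this]
  ring

lemma inv_Gamma_one_sub (z : ℂ) (hz : 0 < z.re) :
    (Complex.Gamma (1 - z))⁻¹ = Complex.Gamma z * Complex.sin (Real.pi * z) / Real.pi := by
  have h := Complex.Gamma_mul_Gamma_one_sub z
  have h0 := Complex.Gamma_ne_zero_of_re_pos hz
  have h2 : Complex.Gamma (1 - z) = Real.pi / Complex.sin (Real.pi * z) / Complex.Gamma z := by
    rw [← h]; field_simp
  rw [h2, inv_div, div_div_eq_mul_div]

lemma exists_norm_cpow_mul_stableLaplace_le {α a : ℝ} (hα : 1 < α) (hα' : α ≤ 2) (ha : 0 < a)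
    {p : ℝ} (hp : 0 < p) {c : ℝ} (hc : 0 ≤ c) :
    ∃ C, ∀ s : ℂ, 0 ≤ s.re → s.re ≤ c →
      ‖s ^ (p : ℂ) * stableLaplace α a s‖ ≤ C * Real.exp (-‖s‖) := by
  obtain ⟨M, hM0, hM⟩ := exists_norm_stableLaplace_le hα hα' ha hc 2
  obtain ⟨N, hN⟩ := exists_nat_gt ‖(p : ℂ)‖
  refine ⟨N.factorial * Real.exp (Real.pi * N) * M, fun s h0 h1 => ?_⟩
  have hs : ‖s ^ (p : ℂ)‖ ≤ N.factorial * Real.exp (Real.pi * N) * Real.exp ‖s‖ := by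
    rcases le_or_gt 1 ‖s‖ with h | h
    · exact norm_cpow_le_of_one_le h hN.le
    · have h2 : ‖s‖ ^ p ≤ 1 := Real.rpow_le_one (norm_nonneg s) h.le hp.le
      have h3 : (1 : ℝ) ≤ N.factorial := by exact_mod_cast N.factorial_pos
      have h4 : 1 ≤ Real.exp (Real.pi * N) := Real.one_le_exp (by positivity)
      have h5 : 1 ≤ Real.exp ‖s‖ := Real.one_le_exp (by positivity)
      have h6 := norm_cpow_le_mul_exp s p
      simp only [Complex.ofReal_re, Complex.ofReal_im, abs_zero, mul_zero, Real.exp_zero,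
        mul_one] at h6
      calc _ ≤ 1 := h6.trans h2
        _ ≤ _ := one_le_mul_of_one_le_of_one_le (one_le_mul_of_one_le_of_one_le h3 h4) h5
  rw [norm_mul]
  refine (mul_le_mul hs (hM s h0 h1) (norm_nonneg _) (by positivity)).trans (le_of_eq ?_)
  rw [show -‖s‖ = ‖s‖ + -(2 * ‖s‖) by ring, Real.exp_add]
  ring

/-- Since `p > 0`, the integrand extends continuously to `s = 0` and the line can move to the
imaginary axis. With `w = (p+1)/α`, the two half lines carry conjugate phases summing to `2
sin(πw)`, and reflection turns `Γ(w) sin(πw)` into `π/Γ(1-w)`. -/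
lemma stableMellin_ofReal {α a c p : ℝ} (hα : 1 < α) (hα' : α ≤ 2) (ha : 0 < a) (hc : 0 ≤ c)
    (hp : 0 < p) :
    stableMellin α a c p = 2 * Real.pi / α * (a : ℂ) ^ (-((p + 1) / α) : ℂ) *
      (Complex.Gamma (1 - (p + 1) / α))⁻¹ := by
  obtain ⟨C, hC⟩ := exists_norm_cpow_mul_stableLaplace_le hα hα' ha hp hc
  have hcont : ContinuousOn (fun s : ℂ => s ^ (p : ℂ) * stableLaplace α a s) {s | 0 ≤ s.re} :=
    ContinuousOn.mul (fun s hs => (Complex.continuousAt_cpow_const_of_re_pos (Or.inl hs)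
      (by simpa)).continuousWithinAt) (continuousOn_stableLaplace hα a)
  have hshift := integral_verticalLine_eq hcont (fun s hs => (differentiableAt_id.cpow_const
    (Or.inl hs)).mul (differentiableAt_stableLaplace α a hs)) le_rfl hc hC
  have hint : Integrable fun y : ℝ => ((y : ℂ) * I) ^ (p : ℂ) * stableLaplace α a (y * I) := by
    refine (integrable_exp_neg_abs.const_mul C).mono' ?_ (.of_forall fun y => ?_)
    · refine (hcont.comp_continuous (f := fun y : ℝ => (y : ℂ) * I) (by fun_prop)
        (fun y => by simp)).aestronglyMeasurable
    · simpa using hC (y * I) (by simp) (by simpa)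
  rw [stableMellin, ← hshift]
  simp only [Complex.ofReal_zero, zero_add]
  rw [← intervalIntegral.integral_Iic_add_Ioi (b := 0) hint.integrableOn hint.integrableOn,
    ← neg_zero, ← integral_comp_neg_Ioi, neg_zero]
  have h1 := integral_halfLine_stableLaplace hα hα' ha (by linarith : -1 < p) (ε := 1) (Or.inl rfl)
  have h2 := integral_halfLine_stableLaplace hα hα' ha (by linarith : -1 < p) (ε := -1) (Or.inr rfl)
  simp only [Complex.ofReal_one, one_mul, Complex.ofReal_neg, neg_mul, mul_neg] at h1 h2
  simp only [Complex.ofReal_neg, neg_mul]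
  rw [h1, h2, ← mul_add]
  have hw : 0 < (p + 1) / α := by positivity
  have hG := inv_Gamma_one_sub (((p + 1) / α : ℝ) : ℂ) (by rw [Complex.ofReal_re]; exact hw)
  have hsin : cexp (-((Real.pi * ((p + 1) / α) - Real.pi / 2) * I)) +
      cexp ((Real.pi * ((p + 1) / α) - Real.pi / 2) * I) =
      2 * Complex.sin (Real.pi * ((p + 1) / α)) := by
    rw [← Complex.cos_sub_pi_div_two, Complex.cos]
    ring_nf
  have hcp : ((a ^ (-((p + 1) / α)) : ℝ) : ℂ) = (a : ℂ) ^ (-((p + 1) / α) : ℂ) := by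
    rw [Complex.ofReal_cpow ha.le]; push_cast; rfl
  push_cast at hG
  rw [hsin, hG, hcp, ← Complex.Gamma_ofReal]
  have hpi : (Real.pi : ℂ) ≠ 0 := by exact_mod_cast Real.pi_ne_zero
  push_cast
  field_simp

/-- The vertical line integral of `s^p exp (a s^α)` in closed form. -/
lemma stableMellin_eq {α a c : ℝ} (hα : 1 < α) (hα' : α ≤ 2) (ha : 0 < a) (hc : 1 ≤ c) (p : ℂ) :
    stableMellin α a c p = 2 * Real.pi / α * (a : ℂ) ^ (-((p + 1) / α) : ℂ) *
      (Complex.Gamma (1 - (p + 1) / α))⁻¹ := by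
  have hα0 : (α : ℂ) ≠ 0 := by exact_mod_cast (by linarith : α ≠ 0)
  have h1 := (differentiable_stableMellin hα hα' ha hc).differentiableOn.analyticOnNhd
    isOpen_univ
  have ha' : (a : ℂ) ≠ 0 := by exact_mod_cast ha.ne'
  have h2 : Differentiable ℂ (fun p : ℂ => 2 * Real.pi / α * (a : ℂ) ^ (-((p + 1) / α) : ℂ) *
      (Complex.Gamma (1 - (p + 1) / α))⁻¹) := by
    refine Differentiable.mul (Differentiable.const_mul (fun p => DifferentiableAt.const_cpow
      (by fun_prop) (Or.inl ha')) _) ?_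
    exact Complex.differentiable_one_div_Gamma.comp (by fun_prop)
  -- Continuation in `p` is essential: the pricing series uses `p = n - m - 1`, which is often
  -- negative.
  refine congrFun (h1.eq_of_frequently_eq (h2.differentiableOn.analyticOnNhd isOpen_univ)
    (z₀ := 1) ?_) p
  refine tendsto_one_add_one_div_nhdsNE.frequently (Frequently.of_forall fun n => ?_)
  exact stableMellin_ofReal hα hα' ha (by linarith) (by positivity)

end StableIntegralEval

/-! ### Fourier inversion for measures with integrable characteristic function. -/

section InversionDensity

open Complex FourierTransform SchwartzMap

/-- The Fourier inversion integral of the characteristic function of a measure on `ℝ`. -/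
noncomputable def inversionDensity (ν : Measure ℝ) (y : ℝ) : ℂ :=
  (2 * Real.pi : ℂ)⁻¹ * ∫ k : ℝ, cexp (-(k * y * I)) * charFun ν k

lemma inversionDensity_eq_fourier (ν : Measure ℝ) (y : ℝ) :
    inversionDensity ν y = 𝓕 (fun x : ℝ => charFun ν (2 * Real.pi * x)) y := by
  rw [Real.fourier_real_eq_integral_exp_smul]
  have h := Measure.integral_comp_mul_left
    (fun k : ℝ => cexp (-(k * y * I)) * charFun ν k) (2 * Real.pi)
  rw [inversionDensity]
  have hpi : |(2 * Real.pi)⁻¹| = (2 * Real.pi)⁻¹ := abs_of_pos (by positivity)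
  rw [hpi] at h
  have h2 : ((2 * Real.pi)⁻¹ • ∫ k : ℝ, cexp (-(k * y * I)) * charFun ν k) =
      (2 * Real.pi : ℂ)⁻¹ * ∫ k : ℝ, cexp (-(k * y * I)) * charFun ν k := by
    rw [Complex.real_smul]; push_cast; rfl
  rw [← h2, ← h]
  refine integral_congr_ae (.of_forall fun x => ?_)
  simp only [smul_eq_mul]
  congr 2
  push_cast
  ring

lemma integrable_charFun_comp_mul {ν : Measure ℝ} (hν : Integrable (charFun ν)) :
    Integrable (fun x : ℝ => charFun ν (2 * Real.pi * x)) :=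
  hν.comp_mul_left' (by positivity)

lemma continuous_inversionDensity {ν : Measure ℝ} (hν : Integrable (charFun ν)) :
    Continuous (inversionDensity ν) := by
  have h : inversionDensity ν = 𝓕 (fun x : ℝ => charFun ν (2 * Real.pi * x)) :=
    funext (inversionDensity_eq_fourier ν)
  rw [h]
  exact VectorFourier.fourierIntegral_continuous Real.continuous_fourierChar
    (by exact continuous_inner) (integrable_charFun_comp_mul hν)

/-- Parseval: the self-adjointness of the Fourier transform is used once between two Lebesgue
measures and once between Lebesgue measure and `ν`. -/
lemma integral_schwartz_eq_inversionDensity {ν : Measure ℝ} [IsFiniteMeasure ν]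
    (hν : Integrable (charFun ν)) (g : 𝓢(ℝ, ℂ)) :
    ∫ y, g y ∂ν = ∫ y, g y * inversionDensity ν y := by
  have h1 : ∫ x, 𝓕 (g : ℝ → ℂ) x • charFun ν (2 * Real.pi * x) =
      ∫ y, g y • 𝓕 (fun x : ℝ => charFun ν (2 * Real.pi * x)) y := by
    have := VectorFourier.integral_fourierIntegral_smul_eq_flip (L := innerₗ ℝ)
      (μ := volume) (ν := volume) Real.continuous_fourierChar continuous_inner g.integrable
      (integrable_charFun_comp_mul hν)
    simpa using! this
  have hG : Integrable (𝓕 (g : ℝ → ℂ)) := by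
    rw [← fourier_coe]; exact (𝓕 g).integrable
  have h2 : ∫ y, g y ∂ν = ∫ x, 𝓕 (g : ℝ → ℂ) x • charFun ν (2 * Real.pi * x) := by
    -- The negated pairing makes the transform of `𝓕 g` the inverse one, which returns `g`.
    have := VectorFourier.integral_fourierIntegral_smul_eq_flip (L := -innerₗ ℝ)
      (μ := volume) (ν := ν) (f := 𝓕 (g : ℝ → ℂ)) (g := fun _ => (1 : ℂ))
      Real.continuous_fourierChar (by simpa using! continuous_inner.neg) hG (integrable_const _)
    have h3 : ∀ ξ, VectorFourier.fourierIntegral Real.fourierChar volume (-innerₗ ℝ)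
        (𝓕 (g : ℝ → ℂ)) ξ = g ξ := by
      intro ξ
      have h4 := congrFun (g.continuous.fourierInv_fourier_eq g.integrable hG) ξ
      rw [Real.fourierInv_eq] at h4
      rw [← h4, VectorFourier.fourierIntegral]
      simp
    have h5 : ∀ x, VectorFourier.fourierIntegral Real.fourierChar ν (-innerₗ ℝ).flip
        (fun _ => (1 : ℂ)) x = charFun ν (2 * Real.pi * x) := by
      intro x
      rw [VectorFourier.fourierIntegral, charFun_apply_real]
      refine integral_congr_ae (.of_forall fun y => ?_)
      simp [Circle.smul_def, Real.fourierChar_apply]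
      ring_nf
    simpa [h3, h5] using this
  rw [h2, h1]
  simp [inversionDensity_eq_fourier]

lemma measureReal_ball_eq_integral_inversionDensity {ν : Measure ℝ} [IsFiniteMeasure ν]
    (hν : Integrable (charFun ν)) (c : ℝ) {r : ℝ} (hr : 0 < r) :
    (ν.real (Metric.ball c r) : ℂ) = ∫ y in Metric.ball c r, inversionDensity ν y := by
  have hrIn : ∀ n : ℕ, 0 < r * (1 - 1 / ((n : ℝ) + 2)) := fun n => by
    have : 1 / ((n : ℝ) + 2) < 1 := by
      rw [div_lt_one (by positivity)]; linarith [(Nat.cast_nonneg n : (0 : ℝ) ≤ n)]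
    exact mul_pos hr (by linarith)
  -- Inner radii tend to the outer radius `r`, so the bumps converge to the indicator of the open
  -- ball; `n + 2` keeps the first inner radius positive.
  let b : ℕ → ContDiffBump c := fun n =>
    ⟨r * (1 - 1 / ((n : ℝ) + 2)), r, hrIn n, by
      have : 0 < 1 / ((n : ℝ) + 2) := by positivity
      nlinarith⟩
  have hsm : ∀ n, ContDiff ℝ (⊤ : ℕ∞) (fun y => ((b n y : ℝ) : ℂ)) := fun n =>
    Complex.ofRealCLM.contDiff.comp (b n).contDiff
  have hcs : ∀ n, HasCompactSupport (fun y => ((b n y : ℝ) : ℂ)) := fun n =>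
    (b n).hasCompactSupport.comp_left Complex.ofReal_zero
  have hlim : ∀ y, Tendsto (fun n => ((b n y : ℝ) : ℂ)) atTop
      (𝓝 ((Metric.ball c r).indicator (fun _ => (1 : ℂ)) y)) := by
    intro y
    by_cases hy : y ∈ Metric.ball c r
    · rw [Set.indicator_of_mem hy]
      refine tendsto_const_nhds.congr' ?_
      have h1 : Tendsto (fun n : ℕ => r * (1 - 1 / ((n : ℝ) + 2))) atTop (𝓝 (r * (1 - 0))) :=
        (tendsto_const_nhds.sub (tendsto_const_nhds.div_atTop
          (tendsto_atTop_add_const_right _ _ tendsto_natCast_atTop_atTop))).const_mul r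
      rw [sub_zero, mul_one] at h1
      filter_upwards [h1.eventually (lt_mem_nhds (Metric.mem_ball.1 hy))] with n hn
      rw [(b n).one_of_mem_closedBall (Metric.mem_closedBall.2 hn.le), Complex.ofReal_one]
    · rw [Set.indicator_of_notMem hy]
      refine tendsto_const_nhds.congr fun n => ?_
      rw [(b n).zero_of_le_dist (not_lt.1 hy), Complex.ofReal_zero]
  have hle : ∀ n y, ‖((b n y : ℝ) : ℂ)‖ ≤ (Metric.ball c r).indicator (fun _ => (1 : ℝ)) y := by
    intro n y
    rw [Complex.norm_real, Real.norm_of_nonneg (b n).nonneg]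
    by_cases hy : y ∈ Metric.ball c r
    · rw [Set.indicator_of_mem hy]; exact (b n).le_one
    · rw [Set.indicator_of_notMem hy]; exact ((b n).zero_of_le_dist (not_lt.1 hy)).le
  have hF := continuous_inversionDensity hν
  have hFint : IntegrableOn (inversionDensity ν) (Metric.ball c r) :=
    (hF.locallyIntegrable.integrableOn_isCompact (isCompact_closedBall c r)).mono_set
      Metric.ball_subset_closedBall
  have t1 : Tendsto (fun n => ∫ y, ((b n y : ℝ) : ℂ) ∂ν) atTop
      (𝓝 (∫ y, (Metric.ball c r).indicator (fun _ => (1 : ℂ)) y ∂ν)) :=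
    tendsto_integral_of_dominated_convergence _
      (fun n => (hsm n).continuous.aestronglyMeasurable)
      ((integrable_const (1 : ℝ)).indicator measurableSet_ball)
      (fun n => .of_forall (hle n)) (.of_forall hlim)
  have t2 : Tendsto (fun n => ∫ y, ((b n y : ℝ) : ℂ) * inversionDensity ν y) atTop
      (𝓝 (∫ y, (Metric.ball c r).indicator (fun _ => (1 : ℂ)) y * inversionDensity ν y)) := by
    refine tendsto_integral_of_dominated_convergence
      (fun y => (Metric.ball c r).indicator (fun y => ‖inversionDensity ν y‖) y)
      (fun n => ((hsm n).continuous.mul hF).aestronglyMeasurable)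
      ((integrable_indicator_iff measurableSet_ball).2 hFint.norm)
      (fun n => .of_forall fun y => ?_) (.of_forall fun y => (hlim y).mul_const _)
    rw [norm_mul]
    refine (mul_le_mul_of_nonneg_right (hle n y) (norm_nonneg _)).trans (le_of_eq ?_)
    by_cases hy : y ∈ Metric.ball c r <;> simp [hy]
  have heq : ∀ n, ∫ y, ((b n y : ℝ) : ℂ) ∂ν = ∫ y, ((b n y : ℝ) : ℂ) * inversionDensity ν y :=
    fun n => integral_schwartz_eq_inversionDensity hν ((hcs n).toSchwartzMap (hsm n))
  have h := tendsto_nhds_unique t1 (t2.congr fun n => (heq n).symm)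
  rw [integral_indicator measurableSet_ball, setIntegral_const, Complex.real_smul, mul_one] at h
  rw [h, ← integral_indicator measurableSet_ball]
  refine integral_congr_ae (.of_forall fun y => ?_)
  by_cases hy : y ∈ Metric.ball c r <;> simp [hy]

lemma measureReal_ball_eq_integral_re {ν : Measure ℝ} [IsFiniteMeasure ν]
    (hν : Integrable (charFun ν)) (c : ℝ) {r : ℝ} (hr : 0 < r) :
    ν.real (Metric.ball c r) = ∫ y in Metric.ball c r, (inversionDensity ν y).re := by
  have h := congrArg Complex.re (measureReal_ball_eq_integral_inversionDensity hν c hr)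
  have hFint : IntegrableOn (inversionDensity ν) (Metric.ball c r) :=
    ((continuous_inversionDensity hν).locallyIntegrable.integrableOn_isCompact
      (isCompact_closedBall c r)).mono_set Metric.ball_subset_closedBall
  rw [Complex.ofReal_re] at h
  rw [h]
  exact (integral_re hFint).symm

/-- A negative value would, by continuity, give some small ball negative mass. -/
lemma re_inversionDensity_nonneg {ν : Measure ℝ} [IsFiniteMeasure ν]
    (hν : Integrable (charFun ν)) (y : ℝ) : 0 ≤ (inversionDensity ν y).re := by
  by_contra! hneg
  have hc : Continuous fun y => (inversionDensity ν y).re :=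
    Complex.continuous_re.comp (continuous_inversionDensity hν)
  obtain ⟨δ, hδ, hball⟩ := Metric.eventually_nhds_iff_ball.1
    (hc.continuousAt.eventually (gt_mem_nhds (by linarith :
      (inversionDensity ν y).re < (inversionDensity ν y).re / 2)))
  have h1 := measureReal_ball_eq_integral_re hν y hδ
  have h2 : ∫ z in Metric.ball y δ, (inversionDensity ν z).re ≤
      ∫ _ in Metric.ball y δ, (inversionDensity ν y).re / 2 := by
    refine setIntegral_mono_on ?_ (integrableOn_const measure_ball_lt_top.ne) measurableSet_ball
      fun z hz => (hball z hz).le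
    exact (hc.locallyIntegrable.integrableOn_isCompact
      (isCompact_closedBall y δ)).mono_set Metric.ball_subset_closedBall
  rw [setIntegral_const, smul_eq_mul, ← h1] at h2
  have h3 : 0 ≤ ν.real (Metric.ball y δ) := measureReal_nonneg
  have h4 : 0 < volume.real (Metric.ball y δ) :=
    ENNReal.toReal_pos (Metric.measure_ball_pos _ _ hδ).ne' measure_ball_lt_top.ne
  nlinarith

/-- **Inversion formula**: a finite measure on `ℝ` whose characteristic function is integrable has
a density, given by the Fourier inversion integral. -/
theorem eq_withDensity_inversionDensity {ν : Measure ℝ} [IsFiniteMeasure ν]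
    (hν : Integrable (charFun ν)) :
    ν = volume.withDensity fun y => ENNReal.ofReal (inversionDensity ν y).re := by
  -- Rational open intervals determine the measure, and each nonempty one is a ball.
  refine Real.measure_ext_Ioo_rat fun p q => ?_
  rcases le_or_gt (q : ℝ) p with h | h
  · simp [Set.Ioo_eq_empty (not_lt.2 h)]
  have hc : Continuous fun y => (inversionDensity ν y).re :=
    Complex.continuous_re.comp (continuous_inversionDensity hν)
  rw [withDensity_apply _ measurableSet_Ioo, Real.Ioo_eq_ball,
    ← ofReal_integral_eq_lintegral_ofReal, ← measureReal_ball_eq_integral_re hν _ (by linarith),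
    ofReal_measureReal]
  · exact (hc.locallyIntegrable.integrableOn_isCompact
      (isCompact_closedBall _ _)).mono_set Metric.ball_subset_closedBall
  · exact .of_forall fun y => re_inversionDensity_nonneg hν y

end InversionDensity

/-! ### The totally asymmetric stable law: density and partial exponential moments. -/

section StableLaw

open Complex

/-- Because `(ik)^α = |k|^α (cos(πα/2) + i sgn(k) sin(πα/2))`, factoring out the cosine gives the
tangent term exactly for `β = -1`, and explains the constant `μ`. -/
lemma exp_neg_mul_stableExponent {α σ τ : ℝ} (hα : 1 < α) (hα' : α ≤ 2) (k : ℝ) :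
    cexp (-(τ : ℂ) * stableExponent α σ (-1) k) =
      stableLaplace α (-(fmlsAdjustment α σ * τ)) (k * I) := by
  have hcos := (cos_pi_mul_div_two_neg hα hα').ne
  have hα0 : α ≠ 0 := by linarith
  rw [stableLaplace, stableExponent]
  rcases eq_or_ne k 0 with rfl | hk
  · have : (α : ℂ) ≠ 0 := by exact_mod_cast hα0
    simp [Real.zero_rpow hα0, Complex.zero_cpow this]
  congr 1
  obtain ⟨ε, hε, hs, hkε⟩ : ∃ ε : ℝ, (ε = 1 ∨ ε = -1) ∧ Real.sign k = ε ∧ k = |k| * ε := by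
    rcases hk.lt_or_gt with h | h
    · exact ⟨-1, Or.inr rfl, Real.sign_of_neg h, by rw [abs_of_neg h]; ring⟩
    · exact ⟨1, Or.inl rfl, Real.sign_of_pos h, by rw [abs_of_pos h]; ring⟩
  have hζ0 : (ε : ℂ) * I ≠ 0 := by rcases hε with rfl | rfl <;> simp
  have h1 : ((k : ℂ) * I) ^ (α : ℂ) = (|k| ^ α : ℝ) * (Real.cos (Real.pi * α / 2) +
      ε * Real.sin (Real.pi * α / 2) * I) := by
    have h2 : (k : ℂ) * I = (|k| : ℝ) * (ε * I) := by
      conv_lhs => rw [hkε]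
      push_cast; ring
    rw [h2, ofReal_mul_cpow (abs_pos.2 hk) hζ0, sign_mul_I_cpow hε, ← Complex.ofReal_mul,
      Complex.exp_mul_I, Complex.ofReal_cpow (abs_nonneg k), ← Complex.ofReal_cos,
      ← Complex.ofReal_sin]
    rcases hε with rfl | rfl
    · rw [show 1 * (Real.pi / 2) * α = Real.pi * α / 2 by ring]; simp
    · rw [show -1 * (Real.pi / 2) * α = -(Real.pi * α / 2) by ring, Real.cos_neg, Real.sin_neg]
      simp
  have hcos' : (Real.cos (Real.pi * α / 2) : ℂ) ≠ 0 := by exact_mod_cast hcos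
  rw [h1, hs, fmlsAdjustment, Real.tan_eq_sin_div_cos]
  push_cast at hcos' ⊢
  field_simp
  ring

/-- `ν` has the characteristic function `k ↦ exp (a (ik)^α)`. -/
def IsStableLaw (α a : ℝ) (ν : Measure ℝ) : Prop :=
  ∀ k : ℝ, charFun ν k = stableLaplace α a (k * I)

variable {α a : ℝ} {ν : Measure ℝ}

lemma IsStableLaw.integrable_charFun (h : IsStableLaw α a ν) (hα : 1 < α) (hα' : α ≤ 2)
    (ha : 0 < a) : Integrable (charFun ν) := by
  obtain ⟨M, hM0, hM⟩ := exists_norm_stableLaplace_le hα hα' ha le_rfl 1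
  rw [show charFun ν = fun k : ℝ => stableLaplace α a (k * I) from funext h]
  refine (integrable_exp_neg_abs.const_mul M).mono' ?_ (.of_forall fun k => ?_)
  · exact ((continuousOn_stableLaplace hα a).comp_continuous (f := fun y : ℝ => (y : ℂ) * I)
      (by fun_prop) (fun y => by simp)).aestronglyMeasurable
  · simpa using hM (k * I) (by simp) (by simp)

lemma IsStableLaw.inversionDensity_eq (h : IsStableLaw α a ν) (hα : 1 < α) (hα' : α ≤ 2)
    (ha : 0 < a) {c : ℝ} (hc : 0 ≤ c) (y : ℝ) :
    inversionDensity ν y = (2 * Real.pi : ℂ)⁻¹ *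
      ∫ k : ℝ, cexp (-((c + k * I) * y)) * stableLaplace α a (c + k * I) := by
  -- The rate covers `‖e^{-sy}‖ ≤ e^{|y|‖s‖}` and leaves `e^{-‖s‖}`.
  obtain ⟨M, hM0, hM⟩ := exists_norm_stableLaplace_le hα hα' ha hc (|y| + 1)
  have hshift := integral_verticalLine_eq (F := fun s => cexp (-(s * y)) * stableLaplace α a s)
    (b := 0) (c := c) (C := M)
    (ContinuousOn.mul (by fun_prop) (continuousOn_stableLaplace hα a))
    (fun s hs => DifferentiableAt.mul (by fun_prop) (differentiableAt_stableLaplace α a hs))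
    le_rfl hc (fun s h0 h1 => ?_)
  · rw [inversionDensity, ← hshift]
    congr 1
    refine integral_congr_ae (.of_forall fun k => ?_)
    simp only [h k, Complex.ofReal_zero, zero_add]
    ring_nf
  · rw [norm_mul, Complex.norm_exp]
    have h2 : (-(s * (y : ℂ))).re ≤ ‖s‖ * |y| := by
      refine (Complex.re_le_norm _).trans ?_
      simp
    calc _ ≤ Real.exp (‖s‖ * |y|) * (M * Real.exp (-((|y| + 1) * ‖s‖))) := by
          gcongr
          exact hM s h0 h1
      _ = M * (Real.exp (‖s‖ * |y|) * Real.exp (-((|y| + 1) * ‖s‖))) := by ring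
      _ = _ := by rw [← Real.exp_add]; ring_nf

lemma integrable_stableLaplace_verticalLine (hα : 1 < α) (hα' : α ≤ 2) (ha : 0 < a) {c : ℝ}
    (hc : 0 ≤ c) : Integrable fun k : ℝ => stableLaplace α a (c + k * I) := by
  obtain ⟨M, hM0, hM⟩ := exists_norm_stableLaplace_le hα hα' ha hc 1
  refine (integrable_exp_neg_abs.const_mul M).mono' ?_ (.of_forall fun k => ?_)
  · exact ((continuousOn_stableLaplace hα a).comp_continuous (continuous_verticalLine c)
      (fun y => by simpa)).aestronglyMeasurable
  · refine (hM _ (by simpa) (by simp)).trans ?_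
    have := abs_le_norm_verticalLine c k
    gcongr
    linarith

/-- On `Re s = c` the factor `e^{-sy}` has modulus `e^{-cy}`. As `c` is arbitrary, the right tail is
lighter than any exponential, which makes the payoffs integrable. -/
lemma IsStableLaw.norm_inversionDensity_le (h : IsStableLaw α a ν) (hα : 1 < α) (hα' : α ≤ 2)
    (ha : 0 < a) {c : ℝ} (hc : 0 ≤ c) :
    ∃ D, ∀ y, ‖inversionDensity ν y‖ ≤ D * Real.exp (-(c * y)) := by
  refine ⟨‖(2 * Real.pi : ℂ)⁻¹‖ * ∫ k : ℝ, ‖stableLaplace α a (c + k * I)‖, fun y => ?_⟩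
  rw [h.inversionDensity_eq hα hα' ha hc, norm_mul, mul_assoc]
  gcongr
  refine (norm_integral_le_integral_norm _).trans (le_of_eq ?_)
  rw [← integral_mul_const]
  refine integral_congr_ae (.of_forall fun k => ?_)
  simp only [norm_mul, Complex.norm_exp]
  simp
  ring

lemma IsStableLaw.integrableOn_exp_mul_inversionDensity (h : IsStableLaw α a ν) (hα : 1 < α)
    (hα' : α ≤ 2) (ha : 0 < a) {u : ℝ} (hu : 0 ≤ u) (x : ℝ) :
    IntegrableOn (fun y : ℝ => ((Real.exp (u * (x + y)) : ℝ) : ℂ) * inversionDensity ν y)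
      (Set.Ioi (-x)) := by
  obtain ⟨D, hD⟩ := h.norm_inversionDensity_le hα hα' ha (by linarith : 0 ≤ u + 1)
  have hF := continuous_inversionDensity (h.integrable_charFun hα hα' ha)
  refine Integrable.mono' (g := fun y => D * Real.exp (u * x) * Real.exp (-y))
    ((integrableOn_exp_neg_Ioi (-x)).const_mul _)
    (Continuous.aestronglyMeasurable (by fun_prop)) (.of_forall fun y => ?_)
  rw [norm_mul, Complex.norm_real, Real.norm_of_nonneg (Real.exp_pos _).le]
  calc _ ≤ Real.exp (u * (x + y)) * (D * Real.exp (-((u + 1) * y))) := by gcongr; exact hD y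
    _ = D * (Real.exp (u * (x + y)) * Real.exp (-((u + 1) * y))) := by ring
    _ = D * (Real.exp (u * x) * Real.exp (-y)) := by
      rw [← Real.exp_add, ← Real.exp_add]; ring_nf
    _ = _ := by ring

lemma IsStableLaw.integrableOn_exp [IsFiniteMeasure ν] (h : IsStableLaw α a ν) (hα : 1 < α)
    (hα' : α ≤ 2) (ha : 0 < a) {u : ℝ} (hu : 0 ≤ u) (x : ℝ) :
    IntegrableOn (fun y : ℝ => Real.exp (u * (x + y))) (Set.Ioi (-x)) ν := by
  have hi := h.integrable_charFun hα hα' ha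
  have hm : Measurable fun y => ENNReal.ofReal (inversionDensity ν y).re :=
    (Complex.continuous_re.comp (continuous_inversionDensity hi)).measurable.ennreal_ofReal
  have h1 := (h.integrableOn_exp_mul_inversionDensity hα hα' ha hu x).re
  rw [eq_withDensity_inversionDensity hi, IntegrableOn, restrict_withDensity measurableSet_Ioi,
    integrable_withDensity_iff hm (.of_forall fun y => ENNReal.ofReal_lt_top)]
  refine h1.congr (.of_forall fun y => ?_)
  simp only [RCLike.re_eq_complex_re, Complex.re_ofReal_mul]
  rw [ENNReal.toReal_ofReal (re_inversionDensity_nonneg hi y)]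

lemma IsStableLaw.setIntegral_exp_eq_re [IsFiniteMeasure ν] (h : IsStableLaw α a ν) (hα : 1 < α)
    (hα' : α ≤ 2) (ha : 0 < a) {u : ℝ} (hu : 0 ≤ u) (x : ℝ) :
    ∫ y in Set.Ioi (-x), Real.exp (u * (x + y)) ∂ν =
      (∫ y in Set.Ioi (-x), ((Real.exp (u * (x + y)) : ℝ) : ℂ) * inversionDensity ν y).re := by
  have hi := h.integrable_charFun hα hα' ha
  have hm : Measurable fun y => ENNReal.ofReal (inversionDensity ν y).re :=
    (Complex.continuous_re.comp (continuous_inversionDensity hi)).measurable.ennreal_ofReal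
  have h1 := h.integrableOn_exp_mul_inversionDensity hα hα' ha hu x
  have h2 := integral_re h1
  simp only [RCLike.re_eq_complex_re] at h2
  rw [← h2]
  conv_lhs => rw [eq_withDensity_inversionDensity hi]
  rw [restrict_withDensity measurableSet_Ioi,
    integral_withDensity_eq_integral_toReal_smul hm (.of_forall fun y => ENNReal.ofReal_lt_top)]
  refine integral_congr_ae (.of_forall fun y => ?_)
  simp only [Complex.re_ofReal_mul, smul_eq_mul]
  rw [ENNReal.toReal_ofReal (re_inversionDensity_nonneg hi y), mul_comm]

/-- Fubini: with `s` on the line `Re s = c > u`, the inner integral of `e^{(u-s)y}` over `y > -x`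
converges and produces `e^{sx}/(s-u)`. -/
lemma IsStableLaw.setIntegral_exp_mul_inversionDensity (h : IsStableLaw α a ν) (hα : 1 < α)
    (hα' : α ≤ 2) (ha : 0 < a) {u c : ℝ} (hu : 0 ≤ u) (huc : u < c) (x : ℝ) :
    ∫ y in Set.Ioi (-x), ((Real.exp (u * (x + y)) : ℝ) : ℂ) * inversionDensity ν y =
      (2 * Real.pi : ℂ)⁻¹ * ∫ k : ℝ, cexp ((c + k * I) * x) / (c + k * I - u) *
        stableLaplace α a (c + k * I) := by
  have hc : 0 ≤ c := hu.trans huc.le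
  have hE := integrable_stableLaplace_verticalLine hα hα' ha hc
  have h1 : ∀ y : ℝ, ((Real.exp (u * (x + y)) : ℝ) : ℂ) * inversionDensity ν y =
      (2 * Real.pi : ℂ)⁻¹ * ∫ k : ℝ, cexp (u * x) * cexp ((u - (c + k * I)) * y) *
        stableLaplace α a (c + k * I) := by
    intro y
    rw [h.inversionDensity_eq hα hα' ha hc, mul_left_comm, ← integral_const_mul]
    congr 1
    refine integral_congr_ae (.of_forall fun k => ?_)
    simp only [Complex.ofReal_exp, ← mul_assoc, ← Complex.exp_add]
    congr 2
    push_cast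
    ring
  simp only [h1, integral_const_mul]
  congr 1
  rw [integral_integral_swap]
  · refine integral_congr_ae (.of_forall fun k => ?_)
    simp only [integral_mul_const, integral_const_mul]
    have hre : ((u : ℂ) - (c + k * I)).re < 0 := by simp; linarith
    have h0 : (c : ℂ) + k * I - u ≠ 0 := by
      intro h0
      have := congrArg Complex.re h0
      simp at this
      linarith
    have h0' : (u : ℂ) - (c + k * I) ≠ 0 := by rw [← neg_ne_zero, neg_sub]; exact h0
    rw [integral_exp_mul_complex_Ioi hre]
    congr 1
    rw [neg_div, ← div_neg, neg_sub, ← mul_div_assoc, ← Complex.exp_add]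
    congr 2
    push_cast
    ring
  · have hy : Integrable (fun y : ℝ => cexp (u * x) * ((Real.exp (-(c - u) * y) : ℝ) : ℂ))
        (volume.restrict (Set.Ioi (-x))) := by
      have := exp_neg_integrableOn_Ioi (-x) (sub_pos.2 huc)
      exact (Integrable.ofReal (𝕜 := ℂ) this).const_mul _
    have hp := hy.mul_prod hE
    refine hp.mono ?_ (.of_forall fun z => le_of_eq ?_)
    · refine AEStronglyMeasurable.mul (Continuous.aestronglyMeasurable (by fun_prop)) ?_
      exact (((continuousOn_stableLaplace hα a).comp_continuous (continuous_verticalLine c)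
        (fun y => by simpa)).comp continuous_snd).aestronglyMeasurable
    · simp only [Function.uncurry, norm_mul, Complex.norm_exp, Complex.norm_real, Real.norm_eq_abs,
        Real.abs_exp]
      congr 3
      simp

end StableLaw

/-! ### Expansion of the contour integral into the double series. -/

section PricingSeries

open Complex

lemma hasSum_exp_div_sub {s : ℂ} {u : ℝ} (hu : 0 ≤ u) (hus : u < ‖s‖) (x : ℂ) :
    HasSum (fun p : ℕ × ℕ => (s * x) ^ p.1 / p.1.factorial * ((u : ℂ) ^ p.2 / s ^ (p.2 + 1)))
      (cexp (s * x) / (s - u)) := by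
  have hs : s ≠ 0 := norm_pos_iff.1 (hu.trans_lt hus)
  have hq : ‖(u : ℂ) / s‖ < 1 := by
    rw [norm_div, Complex.norm_real, Real.norm_of_nonneg hu, div_lt_one (hu.trans_lt hus)]
    exact hus
  have h1 : HasSum (fun n : ℕ => (s * x) ^ n / n.factorial) (cexp (s * x)) := by
    rw [Complex.exp_eq_exp_ℂ]
    exact NormedSpace.expSeries_div_hasSum_exp (s * x)
  have h2 : HasSum (fun m : ℕ => (u : ℂ) ^ m / s ^ (m + 1)) (1 / (s - u)) := by
    have h3 := (hasSum_geometric_of_norm_lt_one hq).div_const s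
    have e1 : (1 - (u : ℂ) / s)⁻¹ / s = 1 / (s - u) := by
      rw [div_eq_mul_inv, ← mul_inv, sub_mul, one_mul, div_mul_cancel₀ _ hs, one_div]
    have e2 : (fun m : ℕ => (u : ℂ) ^ m / s ^ (m + 1)) = fun m => ((u : ℂ) / s) ^ m / s := by
      ext m
      rw [div_pow, pow_succ, div_div]
    rwa [e1, ← e2] at h3
  rw [div_eq_mul_one_div]
  have h4 : Summable fun n : ℕ => ‖(s * x) ^ n / n.factorial‖ :=
    NormedSpace.norm_expSeries_div_summable (s * x)
  have h5 : Summable fun m : ℕ => ‖(u : ℂ) ^ m / s ^ (m + 1)‖ := by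
    have := (summable_norm_geometric_of_norm_lt_one hq).div_const ‖s‖
    refine this.congr fun m => ?_
    rw [norm_div, norm_pow, norm_pow, norm_div, div_pow, pow_succ, norm_mul, norm_pow,
      div_div]
  have h6 : Summable fun p : ℕ × ℕ =>
      (s * x) ^ p.1 / p.1.factorial * ((u : ℂ) ^ p.2 / s ^ (p.2 + 1)) :=
    summable_mul_of_summable_norm (f := fun n : ℕ => (s * x) ^ n / n.factorial)
      (g := fun m : ℕ => (u : ℂ) ^ m / s ^ (m + 1)) h4 h5
  exact HasSum.mul (f := fun n : ℕ => (s * x) ^ n / n.factorial)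
      (g := fun m : ℕ => (u : ℂ) ^ m / s ^ (m + 1)) h1 h2 h6

/-- Doubling the argument in `z^n/n! ≤ e^z` gains `2^{-n}`, so both indices decay geometrically at
the price of `e^{2|x|‖s‖}`. The spare factor `1/‖s‖` is at most `1`. -/
lemma norm_exp_div_sub_term_le {s : ℂ} {u : ℝ} (hu : 0 ≤ u) (hus : u + 1 ≤ ‖s‖) (x : ℝ)
    (n m : ℕ) :
    ‖(s * x) ^ n / n.factorial * ((u : ℂ) ^ m / s ^ (m + 1))‖ ≤
      (1 / 2) ^ n * (u / (u + 1)) ^ m * Real.exp (2 * |x| * ‖s‖) := by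
  have h1 : ‖(s * x) ^ n / n.factorial‖ ≤ (1 / 2) ^ n * Real.exp (2 * |x| * ‖s‖) := by
    have h := Real.pow_div_factorial_le_exp (2 * |x| * ‖s‖) (by positivity) n
    calc _ = (1 / 2) ^ n * ((2 * |x| * ‖s‖) ^ n / n.factorial) := by
          rw [norm_div, norm_pow, norm_mul, Complex.norm_real, Real.norm_eq_abs, mul_assoc 2,
            mul_pow 2, mul_div_assoc, ← mul_assoc, ← mul_pow]
          norm_num
          ring
      _ ≤ _ := by gcongr
  have h2 : ‖(u : ℂ) ^ m / s ^ (m + 1)‖ ≤ (u / (u + 1)) ^ m := by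
    rw [norm_div, norm_pow, norm_pow, Complex.norm_real, Real.norm_of_nonneg hu, pow_succ,
      div_pow]
    gcongr
    have h3 : (u + 1) ^ m ≤ ‖s‖ ^ m := by gcongr
    have h4 : 1 ≤ ‖s‖ := by linarith
    calc (u + 1) ^ m = (u + 1) ^ m * 1 := (mul_one _).symm
      _ ≤ _ := by gcongr
  rw [norm_mul]
  calc _ ≤ ((1 / 2) ^ n * Real.exp (2 * |x| * ‖s‖)) * (u / (u + 1)) ^ m := by gcongr
    _ = _ := by ring

/-- The choice `c = u + 1` gives geometric ratio at most `u/(u+1) < 1` on the whole line, and also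
`c ≥ 1`, as `stableMellin_eq` requires. The decay of `stableLaplace` at rate `2|x| + 1` then
justifies termwise integration. -/
lemma hasSum_integral_exp_div_sub {α a u : ℝ} (hα : 1 < α) (hα' : α ≤ 2) (ha : 0 < a)
    (hu : 0 ≤ u) (x : ℝ) :
    HasSum (fun p : ℕ × ℕ => (x : ℂ) ^ p.1 / p.1.factorial * (u : ℂ) ^ p.2 *
        stableMellin α a (u + 1) ((p.1 : ℂ) - (p.2 + 1)))
      (∫ k : ℝ, cexp (((u + 1 : ℝ) + k * I) * x) / ((u + 1 : ℝ) + k * I - u) *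
        stableLaplace α a ((u + 1 : ℝ) + k * I)) := by
  set c : ℝ := u + 1 with hc
  have hc0 : 0 < c := by positivity
  have hnorm : ∀ k : ℝ, c ≤ ‖(c : ℂ) + k * I‖ := fun k => by
    simpa using Complex.re_le_norm ((c : ℂ) + k * I)
  have hne : ∀ k : ℝ, (c : ℂ) + k * I ≠ 0 := fun k => norm_pos_iff.1 (hc0.trans_le (hnorm k))
  obtain ⟨M, hM0, hM⟩ := exists_norm_stableLaplace_le hα hα' ha hc0.le (2 * |x| + 1)
  set F : ℕ × ℕ → ℝ → ℂ := fun p k => ((c + k * I) * x) ^ p.1 / p.1.factorial *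
    ((u : ℂ) ^ p.2 / (c + k * I) ^ (p.2 + 1)) * stableLaplace α a (c + k * I) with hF
  have hFle : ∀ p k, ‖F p k‖ ≤
      (1 / 2) ^ p.1 * (u / (u + 1)) ^ p.2 * (M * Real.exp (-|k|)) := by
    intro p k
    rw [hF, norm_mul]
    have h1 := norm_exp_div_sub_term_le hu (hnorm k) x p.1 p.2
    have h2 := hM (c + k * I) (by simpa using hc0.le) (by simp)
    have h3 := abs_le_norm_verticalLine c k
    calc _ ≤ ((1 / 2) ^ p.1 * (u / (u + 1)) ^ p.2 * Real.exp (2 * |x| * ‖(c : ℂ) + k * I‖)) *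
          (M * Real.exp (-((2 * |x| + 1) * ‖(c : ℂ) + k * I‖))) := by gcongr
      _ = (1 / 2) ^ p.1 * (u / (u + 1)) ^ p.2 * (M * (Real.exp (2 * |x| * ‖(c : ℂ) + k * I‖) *
          Real.exp (-((2 * |x| + 1) * ‖(c : ℂ) + k * I‖)))) := by ring
      _ ≤ _ := by
        rw [← Real.exp_add]
        gcongr
        linarith
  have hbint : ∀ p : ℕ × ℕ, Integrable fun k : ℝ =>
      (1 / 2) ^ p.1 * (u / (u + 1)) ^ p.2 * (M * Real.exp (-|k|)) := fun p =>
    (integrable_exp_neg_abs.const_mul M).const_mul _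
  have hFint : ∀ p, Integrable (F p) := by
    intro p
    refine (hbint p).mono' ?_ (.of_forall (hFle p))
    refine Continuous.aestronglyMeasurable (Continuous.mul (Continuous.mul (by fun_prop) ?_) ?_)
    · exact continuous_const.div (by fun_prop) fun k => pow_ne_zero _ (hne k)
    · exact (continuousOn_stableLaplace hα a).comp_continuous (continuous_verticalLine c)
        (fun y => by simpa using hc0.le)
  have hgeo : Summable fun p : ℕ × ℕ => ((1 / 2 : ℝ) ^ p.1 * (u / (u + 1)) ^ p.2) := by
    refine (summable_geometric_of_lt_one (by norm_num) (by norm_num)).mul_of_nonneg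
      (summable_geometric_of_lt_one (by positivity) ?_) (fun _ => by positivity)
      (fun _ => by positivity)
    rw [div_lt_one (by positivity)]
    linarith
  have hsum : Summable fun p => ∫ k, ‖F p k‖ := by
    refine Summable.of_nonneg_of_le (fun p => integral_nonneg fun k => norm_nonneg _)
      (fun p => integral_mono (hFint p).norm (hbint p) (hFle p)) ?_
    simp only [integral_const_mul]
    exact hgeo.mul_right _
  have key := hasSum_integral_of_summable_integral_norm hFint hsum
  have h1 : ∀ k : ℝ, ∑' p, F p k = cexp ((c + k * I) * x) / (c + k * I - u) *
      stableLaplace α a (c + k * I) := fun k =>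
    ((hasSum_exp_div_sub hu (by linarith [hnorm k] : u < ‖(c : ℂ) + k * I‖) x).mul_right
      _).tsum_eq
  have h2 : ∀ p : ℕ × ℕ, ∫ k, F p k = (x : ℂ) ^ p.1 / p.1.factorial * (u : ℂ) ^ p.2 *
      stableMellin α a c ((p.1 : ℂ) - (p.2 + 1)) := by
    intro p
    rw [stableMellin, ← integral_const_mul]
    refine integral_congr_ae (.of_forall fun k => ?_)
    have h3 : ((c : ℂ) + k * I) ^ ((p.1 : ℂ) - (p.2 + 1)) =
        (c + k * I) ^ p.1 / (c + k * I) ^ (p.2 + 1) := by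
      rw [Complex.cpow_sub _ _ (hne k), Complex.cpow_natCast, ← Nat.cast_add_one,
        Complex.cpow_natCast]
    simp only [hF, h3, mul_pow]
    ring
  simp only [h1, h2] at key
  exact key

lemma stableMellin_natCast_sub {α a c : ℝ} (hα : 1 < α) (hα' : α ≤ 2) (ha : 0 < a) (hc : 1 ≤ c)
    (n m : ℕ) :
    stableMellin α a c ((n : ℂ) - (m + 1)) = 2 * Real.pi / α *
      ((a ^ (((m : ℝ) - n) / α) * (Real.Gamma (1 + ((m : ℝ) - n) / α))⁻¹ : ℝ) : ℂ) := by
  rw [stableMellin_eq hα hα' ha hc]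
  have h1 : -(((n : ℂ) - (m + 1) + 1) / α) = (((m : ℝ) - n) / α : ℝ) := by
    push_cast; ring
  have h2 : 1 - ((n : ℂ) - (m + 1) + 1) / α = (1 + ((m : ℝ) - n) / α : ℝ) := by
    push_cast; ring
  rw [h1, h2, Complex.Gamma_ofReal, ← Complex.ofReal_cpow ha.le]
  push_cast
  ring

/-- The double series for the upper partial exponential moments of the stable law. -/
theorem IsStableLaw.hasSum_setIntegral_exp {α a : ℝ} {ν : Measure ℝ} [IsFiniteMeasure ν]
    (h : IsStableLaw α a ν) (hα : 1 < α) (hα' : α ≤ 2) (ha : 0 < a) {u : ℝ} (hu : 0 ≤ u)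
    (x : ℝ) :
    HasSum (fun p : ℕ × ℕ => 1 / α * (1 / ((p.1.factorial : ℝ) *
        Real.Gamma (1 + ((p.2 : ℝ) - p.1) / α)) * u ^ p.2 * x ^ p.1 *
        a ^ (((p.2 : ℝ) - p.1) / α)))
      (∫ y in Set.Ioi (-x), Real.exp (u * (x + y)) ∂ν) := by
  rw [h.setIntegral_exp_eq_re hα hα' ha hu,
    h.setIntegral_exp_mul_inversionDensity hα hα' ha hu (lt_add_one u)]
  have h1 := (hasSum_integral_exp_div_sub hα hα' ha hu x).mul_left (2 * Real.pi : ℂ)⁻¹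
  have h2 : ∀ p : ℕ × ℕ, (2 * Real.pi : ℂ)⁻¹ * ((x : ℂ) ^ p.1 / p.1.factorial * (u : ℂ) ^ p.2 *
      stableMellin α a (u + 1) ((p.1 : ℂ) - (p.2 + 1))) =
      ((1 / α * (1 / ((p.1.factorial : ℝ) * Real.Gamma (1 + ((p.2 : ℝ) - p.1) / α)) * u ^ p.2 *
        x ^ p.1 * a ^ (((p.2 : ℝ) - p.1) / α)) : ℝ) : ℂ) := by
    intro p
    have hpi : (Real.pi : ℂ) ≠ 0 := by exact_mod_cast Real.pi_ne_zero
    rw [stableMellin_natCast_sub hα hα' ha (by linarith), one_div ((p.1.factorial : ℝ) * _),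
      mul_inv]
    push_cast
    field_simp
  simp only [h2] at h1
  simpa only [Complex.ofReal_re] using Complex.hasSum_re h1

end PricingSeries

/-! ### Conditional expectation with an independent variable. -/

section IndependentConditioning

/-- Conditioning a function of an `m`-measurable variable and of a variable independent of `m`
integrates the latter out. -/
lemma condExp_comp_indep_ae_eq {Ω : Type*} {m mΩ : MeasurableSpace Ω} {Q : Measure Ω}
    [IsProbabilityMeasure Q] (hm : m ≤ mΩ) {Y Z : Ω → ℝ} (hY : Measurable Y)
    (hind : Indep (MeasurableSpace.comap Y inferInstance) m Q) (hZ : Measurable[m] Z)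
    {f : ℝ × ℝ → ℝ} (hf : Measurable f) (hint : Integrable (fun ω => f (Z ω, Y ω)) Q) :
    Q[fun ω => f (Z ω, Y ω) | m] =ᵐ[Q] fun ω => ∫ y, f (Z ω, y) ∂(Q.map Y) := by
  have hprob : IsProbabilityMeasure (Q.map Y) := Measure.isProbabilityMeasure_map hY.aemeasurable
  have hprod : ∀ {E : Type} [MeasurableSpace E] {W : Ω → E} (_ : Measurable[m] W),
      Q.map (fun ω => (W ω, Y ω)) = (Q.map W).prod (Q.map Y) := by
    intro E _ W hW
    have hi : IndepFun W Y Q :=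
      (IndepFun_iff_Indep _ _ _).2 (indep_of_indep_of_le_right hind hW.comap_le).symm
    exact (indepFun_iff_map_prod_eq_prod_map_map (hW.mono hm le_rfl).aemeasurable
      hY.aemeasurable).1 hi
  have hZ' : Measurable Z := hZ.mono hm le_rfl
  have hsm : StronglyMeasurable fun z => ∫ y, f (z, y) ∂(Q.map Y) :=
    hf.stronglyMeasurable.integral_prod_right'
  have hfprod : Integrable f ((Q.map Z).prod (Q.map Y)) := by
    rw [← hprod hZ]
    exact (integrable_map_measure hf.aestronglyMeasurable
      (hZ'.prodMk hY).aemeasurable).2 hint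
  have hI : Integrable (fun ω => ∫ y, f (Z ω, y) ∂(Q.map Y)) Q :=
    hfprod.integral_prod_left.comp_measurable hZ'
  refine (ae_eq_condExp_of_forall_setIntegral_eq hm hint (fun s _ _ => hI.integrableOn)
    (fun s hs _ => ?_) (hsm.comp_measurable hZ).aestronglyMeasurable).symm
  -- Bundling the indicator of `s` with `Z` gives an `m`-measurable pair independent of `Y`, so the
  -- integral over `s` is one against a product law.
  set W : Ω → ℝ × ℝ := fun ω => (s.indicator (fun _ => 1) ω, Z ω) with hW
  have hWm : Measurable[m] W := (measurable_const.indicator hs).prodMk hZ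
  have hWm' : Measurable W := hWm.mono hm le_rfl
  set g : (ℝ × ℝ) × ℝ → ℝ := fun q => q.1.1 * f (q.1.2, q.2) with hg
  have hgm : Measurable g := by fun_prop
  have hgW : (fun ω => g (W ω, Y ω)) = s.indicator fun ω => f (Z ω, Y ω) := by
    ext ω
    by_cases hω : ω ∈ s <;> simp [hg, hW, hω]
  have hgint : Integrable g ((Q.map W).prod (Q.map Y)) := by
    rw [← hprod hWm]
    refine (integrable_map_measure hgm.aestronglyMeasurable (hWm'.prodMk hY).aemeasurable).2 ?_
    have := hint.indicator (hm s hs)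
    rwa [← hgW] at this
  have h1 : ∫ ω in s, f (Z ω, Y ω) ∂Q = ∫ w, ∫ y, g (w, y) ∂(Q.map Y) ∂(Q.map W) := by
    rw [← integral_indicator (hm s hs), ← hgW, ← integral_prod _ hgint, ← hprod hWm,
      integral_map (hWm'.prodMk hY).aemeasurable hgm.aestronglyMeasurable]
  rw [h1, integral_map hWm'.aemeasurable
    hgm.stronglyMeasurable.integral_prod_right'.aestronglyMeasurable,
    ← integral_indicator (hm s hs)]
  refine integral_congr_ae (.of_forall fun ω => ?_)
  by_cases hω : ω ∈ s <;> simp [hg, hW, hω]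

end IndependentConditioning

/-! ### Payoffs and option values in the FMLS model. -/

section FMLSModel

lemma fmlsAdjustment_neg {α σ : ℝ} (hα : 1 < α) (hα' : α ≤ 2) (hσ : 0 < σ) :
    fmlsAdjustment α σ < 0 :=
  div_neg_of_pos_of_neg (Real.rpow_pos_of_pos hσ α) (cos_pi_mul_div_two_neg hα hα')

lemma measurableSet_exercise (u K : ℝ) : MeasurableSet {s : ℝ | s ^ u - K > 0} :=
  measurableSet_lt measurable_const ((measurable_id.pow_const u).sub_const K)

lemma measurable_assetOrNothing (u K : ℝ) : Measurable (assetOrNothing u K) :=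
  (measurable_id.pow_const u).indicator (measurableSet_exercise u K)

lemma measurable_cashOrNothing (u K : ℝ) : Measurable (cashOrNothing u K) :=
  measurable_const.indicator (measurableSet_exercise u K)

lemma gapCall_eq (u K₁ K₂ s : ℝ) :
    gapCall u K₁ K₂ s = assetOrNothing u K₂ s - K₁ * cashOrNothing u K₂ s := by
  by_cases h : K₂ < s ^ u <;> simp [gapCall, assetOrNothing, cashOrNothing, Set.indicator, h]

lemma europeanCall_eq_gapCall (u K s : ℝ) : europeanCall u K s = gapCall u K K s := by
  by_cases h : K < s ^ u
  · simp [gapCall, europeanCall, Set.indicator, h, h.le]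
  · simp [gapCall, europeanCall, Set.indicator, h, not_lt.1 h]

/-- The power of the terminal price in terms of the log-forward moneyness and the increment of
the driving process. -/
lemma rpow_price_eq {u s K r μ τ y : ℝ} (hu : 0 < u) (hs : 0 < s) (hK : 0 < K) :
    (s * Real.exp ((r + μ) * τ + y)) ^ u =
      K * Real.exp (u * (logForwardMoneyness u s K r τ + μ * τ + y)) := by
  rw [logForwardMoneyness, Real.log_div hs.ne' (by positivity), Real.log_rpow hK,
    Real.rpow_def_of_pos (by positivity), Real.log_mul hs.ne' (Real.exp_pos _).ne', Real.log_exp]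
  conv_rhs => rw [← Real.exp_log hK, ← Real.exp_add]
  rw [Real.log_exp]
  congr 1
  field_simp
  ring

lemma price_exercise_iff {u s K r μ τ y : ℝ} (hu : 0 < u) (hs : 0 < s) (hK : 0 < K) :
    (s * Real.exp ((r + μ) * τ + y)) ^ u - K > 0 ↔
      y ∈ Set.Ioi (-(logForwardMoneyness u s K r τ + μ * τ)) := by
  rw [rpow_price_eq hu hs hK, Set.mem_Ioi, gt_iff_lt, sub_pos, lt_mul_iff_one_lt_right hK,
    Real.one_lt_exp_iff, mul_pos_iff_of_pos_left hu]
  constructor <;> intro h <;> linarith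

lemma assetOrNothing_price {u s K r μ τ : ℝ} (hu : 0 < u) (hs : 0 < s) (hK : 0 < K) (y : ℝ) :
    assetOrNothing u K (s * Real.exp ((r + μ) * τ + y)) =
      (Set.Ioi (-(logForwardMoneyness u s K r τ + μ * τ))).indicator
        (fun y => K * Real.exp (u * (logForwardMoneyness u s K r τ + μ * τ + y))) y := by
  have h := price_exercise_iff (r := r) (μ := μ) (τ := τ) (y := y) hu hs hK
  simp only [assetOrNothing, Set.indicator, Set.mem_ofPred_eq, h]
  rw [rpow_price_eq hu hs hK]

lemma cashOrNothing_price {u s K r μ τ : ℝ} (hu : 0 < u) (hs : 0 < s) (hK : 0 < K) (y : ℝ) :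
    cashOrNothing u K (s * Real.exp ((r + μ) * τ + y)) =
      (Set.Ioi (-(logForwardMoneyness u s K r τ + μ * τ))).indicator
        (fun y => Real.exp (0 * (logForwardMoneyness u s K r τ + μ * τ + y))) y := by
  have h := price_exercise_iff (r := r) (μ := μ) (τ := τ) (y := y) hu hs hK
  simp only [cashOrNothing, Set.indicator, Set.mem_ofPred_eq, h, zero_mul, Real.exp_zero]

variable {Ω : Type*} {mΩ : MeasurableSpace Ω} {Q : Measure Ω} {ℱ : Filtration ℝ≥0 mΩ}
  {α σ r S₀ u : ℝ} {X : ℝ≥0 → Ω → ℝ} {t T : ℝ≥0}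

lemma fmlsPrice_pos (hS₀ : 0 < S₀) (t : ℝ≥0) (ω : Ω) : 0 < fmlsPrice α σ r S₀ X t ω :=
  mul_pos hS₀ (Real.exp_pos _)

lemma fmlsPrice_eq_mul (t T : ℝ≥0) (ω : Ω) :
    fmlsPrice α σ r S₀ X T ω = fmlsPrice α σ r S₀ X t ω *
      Real.exp ((r + fmlsAdjustment α σ) * ((T : ℝ) - t) + (X T ω - X t ω)) := by
  rw [fmlsPrice, fmlsPrice, mul_assoc, ← Real.exp_add]
  ring_nf

lemma IsFMLSProcess.measurable (hX : IsFMLSProcess Q ℱ α σ X) (t : ℝ≥0) : Measurable (X t) :=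
  (hX.adapted t).mono (ℱ.le t) le_rfl

lemma IsFMLSProcess.measurable_fmlsPrice (hX : IsFMLSProcess Q ℱ α σ X) (t : ℝ≥0) :
    Measurable[ℱ t] (fmlsPrice α σ r S₀ X t) := by
  have := hX.adapted t
  exact (Real.measurable_exp.comp (this.const_add _)).const_mul _

lemma IsFMLSProcess.isStableLaw (hX : IsFMLSProcess Q ℱ α σ X) (hα : 1 < α) (hα' : α ≤ 2)
    (t : ℝ≥0) : IsStableLaw α (-(fmlsAdjustment α σ * t)) (Q.map (X t)) := fun k => by
  rw [hX.charFun_eq, exp_neg_mul_stableExponent hα hα']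

lemma IsFMLSProcess.isStableLaw_sub (hX : IsFMLSProcess Q ℱ α σ X) (hα : 1 < α) (hα' : α ≤ 2)
    (htT : t ≤ T) : IsStableLaw α (-(fmlsAdjustment α σ * ((T : ℝ) - t)))
      (Q.map fun ω => X T ω - X t ω) := by
  rw [(hX.stationary t T htT).map_eq, ← NNReal.coe_sub htT]
  exact hX.isStableLaw hα hα' _

lemma IsFMLSProcess.integrable_assetOrNothing [IsProbabilityMeasure Q]
    (hX : IsFMLSProcess Q ℱ α σ X) (hα : 1 < α) (hα' : α ≤ 2) (hσ : 0 < σ) (hS₀ : 0 < S₀)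
    (hu : 0 < u) (hT : 0 < T) {K : ℝ} (hK : 0 < K) :
    Integrable (fun ω => assetOrNothing u K (fmlsPrice α σ r S₀ X T ω)) Q := by
  have ha : 0 < -(fmlsAdjustment α σ * T) := by
    have := fmlsAdjustment_neg hα hα' hσ
    have hT' : (0 : ℝ) < T := hT
    nlinarith
  have h1 := ((hX.isStableLaw hα hα' T).integrableOn_exp hα hα' ha hu.le
    (logForwardMoneyness u S₀ K r T + fmlsAdjustment α σ * T)).const_mul K
  have h2 := ((integrable_indicator_iff measurableSet_Ioi).2 h1).comp_measurable (hX.measurable T)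
  refine h2.congr (.of_forall fun ω => ?_)
  exact (assetOrNothing_price hu hS₀ hK (X T ω)).symm

lemma integrable_cashOrNothing [IsFiniteMeasure Q] {S : Ω → ℝ} (hS : Measurable S) (u K : ℝ) :
    Integrable (fun ω => cashOrNothing u K (S ω)) Q := by
  refine (integrable_const (1 : ℝ)).mono'
    ((measurable_cashOrNothing u K).comp hS).aestronglyMeasurable (.of_forall fun ω => ?_)
  by_cases h : K < S ω ^ u <;> simp [cashOrNothing, Set.indicator, h]

lemma IsFMLSProcess.optionValue_ae_eq [IsProbabilityMeasure Q] (hX : IsFMLSProcess Q ℱ α σ X)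
    (htT : t ≤ T) {payoff : ℝ → ℝ} (hp : Measurable payoff)
    (hint : Integrable (fun ω => payoff (fmlsPrice α σ r S₀ X T ω)) Q) :
    optionValue Q ℱ r (fmlsPrice α σ r S₀ X) payoff t T =ᵐ[Q] fun ω =>
      Real.exp (-r * ((T : ℝ) - t)) * ∫ y, payoff (fmlsPrice α σ r S₀ X t ω *
        Real.exp ((r + fmlsAdjustment α σ) * ((T : ℝ) - t) + y))
          ∂(Q.map fun ω => X T ω - X t ω) := by
  have h := condExp_comp_indep_ae_eq (Q := Q) (Y := fun ω => X T ω - X t ω) (ℱ.le t)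
    ((hX.measurable T).sub (hX.measurable t)) (hX.indep t T htT)
    (hX.measurable_fmlsPrice (r := r) (S₀ := S₀) t)
    (f := fun q => Real.exp (-r * ((T : ℝ) - t)) * payoff (q.1 *
      Real.exp ((r + fmlsAdjustment α σ) * ((T : ℝ) - t) + q.2))) (by fun_prop) (by
        simp only [← fmlsPrice_eq_mul]
        exact hint.const_mul _)
  simp only [← fmlsPrice_eq_mul, integral_const_mul] at h
  exact h

/-- The pricing series of the partial exponential moments of the increment. -/
lemma IsFMLSProcess.hasSum_fmlsTerm [IsProbabilityMeasure Q] (hX : IsFMLSProcess Q ℱ α σ X)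
    (hα : 1 < α) (hα' : α ≤ 2) (hσ : 0 < σ) (htT : t < T) {v : ℝ} (hv : 0 ≤ v) (k : ℝ) :
    HasSum (fun p : ℕ × ℕ => fmlsTerm α v (fmlsAdjustment α σ) k ((T : ℝ) - t) p.1 p.2)
      (α * ∫ y in Set.Ioi (-(k + fmlsAdjustment α σ * ((T : ℝ) - t))),
        Real.exp (v * (k + fmlsAdjustment α σ * ((T : ℝ) - t) + y))
          ∂(Q.map fun ω => X T ω - X t ω)) := by
  have ha : 0 < -(fmlsAdjustment α σ * ((T : ℝ) - t)) := by
    have := fmlsAdjustment_neg hα hα' hσ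
    have hT' : (0 : ℝ) < (T : ℝ) - t := sub_pos.2 htT
    nlinarith
  have hprob : IsProbabilityMeasure (Q.map fun ω => X T ω - X t ω) :=
    Measure.isProbabilityMeasure_map ((hX.measurable T).sub (hX.measurable t)).aemeasurable
  have h := ((hX.isStableLaw_sub hα hα' htT.le).hasSum_setIntegral_exp hα hα' ha hv
    (k + fmlsAdjustment α σ * ((T : ℝ) - t))).mul_left α
  have hα0 : α ≠ 0 := by linarith
  simp only [← mul_assoc α, mul_one_div_cancel hα0, one_mul] at h
  exact h

/-- Since `0^0 = 1`, the series at exponent `0` is the column `m = 0`, which is the same for every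
`u` at fixed `k`. Subtracting it leaves the terms with `m ≥ 1`. -/
lemma hasSum_fmlsTerm_succ {μ k τ A B : ℝ}
    (hA : HasSum (fun p : ℕ × ℕ => fmlsTerm α u μ k τ p.1 p.2) A)
    (hB : HasSum (fun p : ℕ × ℕ => fmlsTerm α 0 μ k τ p.1 p.2) B) :
    HasSum (fun p : ℕ × ℕ => fmlsTerm α u μ k τ p.1 (p.2 + 1)) (A - B) := by
  have hinj : Function.Injective fun p : ℕ × ℕ => (p.1, p.2 + 1) := by
    rintro ⟨a, b⟩ ⟨c, d⟩ h
    simpa using h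
  have e : (fun p : ℕ × ℕ => fmlsTerm α u μ k τ p.1 (p.2 + 1)) =
      (fun p : ℕ × ℕ => fmlsTerm α u μ k τ p.1 p.2 - fmlsTerm α 0 μ k τ p.1 p.2) ∘
        fun p : ℕ × ℕ => (p.1, p.2 + 1) := by
    ext p
    simp [fmlsTerm]
  rw [e]
  refine (hinj.hasSum_iff ?_).2 (hA.sub hB)
  rintro ⟨n, m⟩ hp
  cases m with
  | zero => simp [fmlsTerm]
  | succ m => exact absurd ⟨(n, m), rfl⟩ hp

lemma IsFMLSProcess.optionValue_assetOrNothing [IsProbabilityMeasure Q]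
    (hX : IsFMLSProcess Q ℱ α σ X) (hα : 1 < α) (hα' : α ≤ 2) (hσ : 0 < σ) (hS₀ : 0 < S₀)
    (hu : 0 < u) (htT : t < T) {K : ℝ} (hK : 0 < K) :
    optionValue Q ℱ r (fmlsPrice α σ r S₀ X) (assetOrNothing u K) t T =ᵐ[Q] fun ω =>
      K * Real.exp (-r * ((T : ℝ) - t)) / α * ∑' p : ℕ × ℕ, fmlsTerm α u (fmlsAdjustment α σ)
        (logForwardMoneyness u (fmlsPrice α σ r S₀ X t ω) K r ((T : ℝ) - t))
        ((T : ℝ) - t) p.1 p.2 := by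
  have hα0 : α ≠ 0 := by linarith
  filter_upwards [hX.optionValue_ae_eq (r := r) (S₀ := S₀) htT.le (measurable_assetOrNothing u K)
    (hX.integrable_assetOrNothing hα hα' hσ hS₀ hu (pos_of_gt htT) hK)] with ω hω
  rw [hω, (hX.hasSum_fmlsTerm hα hα' hσ htT hu.le _).tsum_eq]
  simp only [assetOrNothing_price hu (fmlsPrice_pos hS₀ t ω) hK]
  rw [integral_indicator measurableSet_Ioi, integral_const_mul]
  field_simp

/-- The payoff `1` is a partial exponential moment of order `0`; the power `u` enters only through
the moneyness. -/
lemma IsFMLSProcess.optionValue_cashOrNothing [IsProbabilityMeasure Q]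
    (hX : IsFMLSProcess Q ℱ α σ X) (hα : 1 < α) (hα' : α ≤ 2) (hσ : 0 < σ) (hS₀ : 0 < S₀)
    (hu : 0 < u) (htT : t < T) {K : ℝ} (hK : 0 < K) :
    optionValue Q ℱ r (fmlsPrice α σ r S₀ X) (cashOrNothing u K) t T =ᵐ[Q] fun ω =>
      Real.exp (-r * ((T : ℝ) - t)) / α * ∑' p : ℕ × ℕ, fmlsTerm α 0 (fmlsAdjustment α σ)
        (logForwardMoneyness u (fmlsPrice α σ r S₀ X t ω) K r ((T : ℝ) - t))
        ((T : ℝ) - t) p.1 p.2 := by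
  have hα0 : α ≠ 0 := by linarith
  filter_upwards [hX.optionValue_ae_eq (r := r) (S₀ := S₀) htT.le (measurable_cashOrNothing u K)
    (integrable_cashOrNothing ((hX.measurable_fmlsPrice T).mono (ℱ.le T) le_rfl) u K)] with ω hω
  rw [hω, (hX.hasSum_fmlsTerm hα hα' hσ htT le_rfl _).tsum_eq]
  simp only [cashOrNothing_price hu (fmlsPrice_pos hS₀ t ω) hK]
  rw [integral_indicator measurableSet_Ioi]
  field_simp

lemma optionValue_gapCall {S : ℝ≥0 → Ω → ℝ} {K₁ K₂ : ℝ}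
    (hA : Integrable (fun ω => assetOrNothing u K₂ (S T ω)) Q)
    (hC : Integrable (fun ω => cashOrNothing u K₂ (S T ω)) Q) :
    optionValue Q ℱ r S (gapCall u K₁ K₂) t T =ᵐ[Q] fun ω =>
      optionValue Q ℱ r S (assetOrNothing u K₂) t T ω -
        K₁ * optionValue Q ℱ r S (cashOrNothing u K₂) t T ω := by
  have h1 := condExp_sub (hA.const_mul (Real.exp (-r * ((T : ℝ) - t))))
    ((hC.const_mul (Real.exp (-r * ((T : ℝ) - t)))).const_mul K₁) (ℱ t)
  have h2 := condExp_smul (μ := Q) K₁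
    (fun ω => Real.exp (-r * ((T : ℝ) - t)) * cashOrNothing u K₂ (S T ω)) (ℱ t)
  have h3 : (fun ω => Real.exp (-r * ((T : ℝ) - t)) * gapCall u K₁ K₂ (S T ω)) =
      (fun ω => Real.exp (-r * ((T : ℝ) - t)) * assetOrNothing u K₂ (S T ω)) -
      fun ω => K₁ * (Real.exp (-r * ((T : ℝ) - t)) * cashOrNothing u K₂ (S T ω)) := by
    ext ω
    simp only [gapCall_eq, Pi.sub_apply]
    ring
  rw [optionValue, h3]
  filter_upwards [h1, h2] with ω hω1 hω2
  rw [hω1, Pi.sub_apply]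
  congr 1

end FMLSModel

/-! ### The pricing formulas. -/

theorem mainTheorem3 {Ω : Type*} {mΩ : MeasurableSpace Ω} (Q : Measure Ω)
    [IsProbabilityMeasure Q] (ℱ : Filtration ℝ≥0 mΩ) (α σ r S₀ u : ℝ)
    (hα : 1 < α) (hα' : α ≤ 2) (hσ : 0 < σ) (hS₀ : 0 < S₀) (hu : 0 < u)
    (X : ℝ≥0 → Ω → ℝ) (hX : IsFMLSProcess Q ℱ α σ X) (t T : ℝ≥0) (htT : t < T) :
    -- asset-or-nothing
    (∀ K : ℝ, 0 < K →
      Integrable (fun ω => assetOrNothing u K (fmlsPrice α σ r S₀ X T ω)) Q ∧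
      ∀ᵐ ω ∂Q,
        Summable (fun p : ℕ × ℕ => fmlsTerm α u (fmlsAdjustment α σ)
          (logForwardMoneyness u (fmlsPrice α σ r S₀ X t ω) K r ((T : ℝ) - t))
          ((T : ℝ) - t) p.1 p.2) ∧
        optionValue Q ℱ r (fmlsPrice α σ r S₀ X) (assetOrNothing u K) t T ω =
          K * Real.exp (-r * ((T : ℝ) - t)) / α *
            ∑' p : ℕ × ℕ, fmlsTerm α u (fmlsAdjustment α σ)
              (logForwardMoneyness u (fmlsPrice α σ r S₀ X t ω) K r ((T : ℝ) - t))
              ((T : ℝ) - t) p.1 p.2) ∧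
    -- gap call
    (∀ K₁ K₂ : ℝ, 0 < K₁ → 0 < K₂ →
      Integrable (fun ω => gapCall u K₁ K₂ (fmlsPrice α σ r S₀ X T ω)) Q ∧
      Integrable (fun ω => cashOrNothing u K₂ (fmlsPrice α σ r S₀ X T ω)) Q ∧
      ∀ᵐ ω ∂Q,
        optionValue Q ℱ r (fmlsPrice α σ r S₀ X) (gapCall u K₁ K₂) t T ω =
          optionValue Q ℱ r (fmlsPrice α σ r S₀ X) (assetOrNothing u K₂) t T ω -
            K₁ * optionValue Q ℱ r (fmlsPrice α σ r S₀ X) (cashOrNothing u K₂) t T ω) ∧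
    -- European call: the same series with the summation over `n ≥ 0`, `m ≥ 1`
    (∀ K : ℝ, 0 < K →
      Integrable (fun ω => europeanCall u K (fmlsPrice α σ r S₀ X T ω)) Q ∧
      ∀ᵐ ω ∂Q,
        Summable (fun p : ℕ × ℕ => fmlsTerm α u (fmlsAdjustment α σ)
          (logForwardMoneyness u (fmlsPrice α σ r S₀ X t ω) K r ((T : ℝ) - t))
          ((T : ℝ) - t) p.1 (p.2 + 1)) ∧
        optionValue Q ℱ r (fmlsPrice α σ r S₀ X) (europeanCall u K) t T ω =
          K * Real.exp (-r * ((T : ℝ) - t)) / α *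
            ∑' p : ℕ × ℕ, fmlsTerm α u (fmlsAdjustment α σ)
              (logForwardMoneyness u (fmlsPrice α σ r S₀ X t ω) K r ((T : ℝ) - t))
              ((T : ℝ) - t) p.1 (p.2 + 1)) := by 
  have hS : ∀ t, Measurable (fmlsPrice α σ r S₀ X t) := fun t =>
    (hX.measurable_fmlsPrice t).mono (ℱ.le t) le_rfl
  have hT : 0 < T := pos_of_gt htT
  have hA : ∀ K : ℝ, 0 < K →
      Integrable (fun ω => assetOrNothing u K (fmlsPrice α σ r S₀ X T ω)) Q := fun K hK =>
    hX.integrable_assetOrNothing hα hα' hσ hS₀ hu hT hK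
  have hC : ∀ K : ℝ, Integrable (fun ω => cashOrNothing u K (fmlsPrice α σ r S₀ X T ω)) Q :=
    fun K => integrable_cashOrNothing (hS T) u K
  have hG : ∀ K₁ K₂ : ℝ, 0 < K₂ →
      Integrable (fun ω => gapCall u K₁ K₂ (fmlsPrice α σ r S₀ X T ω)) Q := by
    intro K₁ K₂ hK₂
    simp only [gapCall_eq]
    exact (hA K₂ hK₂).sub ((hC K₂).const_mul K₁)
  refine ⟨fun K hK => ⟨hA K hK, ?_⟩, fun K₁ K₂ _ hK₂ => ⟨hG K₁ K₂ hK₂, hC K₂,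
    optionValue_gapCall (hA K₂ hK₂) (hC K₂)⟩, fun K hK => ⟨?_, ?_⟩⟩
  · filter_upwards [hX.optionValue_assetOrNothing hα hα' hσ hS₀ hu htT hK] with ω hω
    exact ⟨(hX.hasSum_fmlsTerm hα hα' hσ htT hu.le _).summable, hω⟩
  · simp only [europeanCall_eq_gapCall]
    exact hG K K hK
  · filter_upwards [hX.optionValue_assetOrNothing hα hα' hσ hS₀ hu htT hK,
      hX.optionValue_cashOrNothing hα hα' hσ hS₀ hu htT hK,
      optionValue_gapCall (r := r) (t := t) (ℱ := ℱ) (K₁ := K) (hA K hK) (hC K)] with ω h1 h2 h3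
    have h4 := hX.hasSum_fmlsTerm hα hα' hσ htT hu.le
      (logForwardMoneyness u (fmlsPrice α σ r S₀ X t ω) K r ((T : ℝ) - t))
    have h5 := hX.hasSum_fmlsTerm hα hα' hσ htT le_rfl
      (logForwardMoneyness u (fmlsPrice α σ r S₀ X t ω) K r ((T : ℝ) - t))
    have h6 := hasSum_fmlsTerm_succ h4 h5
    refine ⟨h6.summable, ?_⟩
    -- Asset-or-nothing minus `K` times cash-or-nothing: both series have the same moneyness and
    -- differ only in the exponent, `u` against `0`.
    rw [show europeanCall u K = gapCall u K K from funext (europeanCall_eq_gapCall u K), h3, h1,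
      h2, h6.tsum_eq, h4.tsum_eq, h5.tsum_eq]
    ring
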